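/- Let $L/K$ be a finite cyclic Galois extension of number fields of degree $n$, and let $S$ be a finite set of primes (finite or infinite) of $K$ that contains all the infinite primes. Let $J_{K,S}$ be the group of fractional ideals of $K$ generated by the finite primes outside $S$, and let the $S$-ideal class group $\mathrm{Cl}_{K,S}$ be the cokernel of the homomorphism $K^\times\to J_{K,S}$ that sends $\alpha$ to the part of the principal ideal $(\alpha)$ outside $S$; its order $h_{K,S}$ is the $S$-class number of $K$. Define $\mathrm{Cl}_{L,S}$ in the same way, with $S$ replaced by the set of primes of $L$ dividing a prime in $S$. Extension of ideals induces the $S$-capitulation map $j_{L/K,S}:\mathrm{Cl}_{K,S}\to\mathrm{Cl}_{L,S}$, whose kernel consists of the $S$-ideal classes of $K$ that become principal in $L$. Put $$e_{L/K,S}=\prod_{v\in S}n_v\prod_{v\notin S}e(v),\qquad n'=\frac{n}{\gcd(n,e_{L/K,S})},$$ where $n_v=[L_w:K_v]$ is the degree of the extension of completions for any prime $w$ of $L$ dividing $v$, and $e(v)$ is the ramification index of $v$ in $L$. Then at least $n'$ $S$-ideal classes of $K$ become principal in $L$; more precisely, $n'$ divides the order of $\ker j_{L/K,S}$. In particular,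 $n'$ divides the $S$-class number $h_{K,S}$. -/

import Mathlib

open scoped nonZeroDivisors NumberField

noncomputable section

namespace SCapitulation

open NumberField IsDedekindDomain
open scoped NumberField.LiesOver

/-! ### Primes of a number field -/

/-- The primes of a number field `K`: the finite primes (nonzero prime ideals of `𝓞 K`) and
the infinite primes. -/
abbrev Place (K : Type*) [Field K] [NumberField K] : Type _ :=
  HeightOneSpectrum (𝓞 K) ⊕ InfinitePlace K

section Below

variable (K : Type*) {L : Type*} [Field K] [NumberField K] [Field L] [NumberField L] [Algebra K L]

/-- The finite prime `w ∩ 𝓞 K` of `K` below a finite prime `w` of `L`. -/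
def finiteBelow (w : HeightOneSpectrum (𝓞 L)) : HeightOneSpectrum (𝓞 K) where
  asIdeal := w.asIdeal.under (𝓞 K)
  isPrime := inferInstance
  ne_bot := mt Ideal.eq_bot_of_comap_eq_bot w.ne_bot

/-- The prime of `K` below a prime of `L`. -/
def Place.below : Place L → Place K :=
  Sum.map (finiteBelow K) (fun w => w.comap (algebraMap K L))

instance finiteBelow_liesOver (w : HeightOneSpectrum (𝓞 L)) :
    w.asIdeal.LiesOver (finiteBelow K w).asIdeal := ⟨rfl⟩

instance infiniteBelow_liesOver (w : InfinitePlace L) :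
    w.LiesOver (w.comap (algebraMap K L)) := ⟨rfl⟩

/-- The completion `K_v → L_w` of the inclusion `K → L` at a finite prime `w` of `L` and the
prime `v` of `K` below it. -/
def finiteCompletionMap (w : HeightOneSpectrum (𝓞 L)) :
    (finiteBelow K w).adicCompletion K →+* w.adicCompletion L :=
  ((HeightOneSpectrum.adicCompletion.equiv L w).symm.toRingHom.comp
    (UniformSpace.Completion.mapRingHom
      (algebraMap (WithVal ((finiteBelow K w).valuation K)) (WithVal (w.valuation L)))
      (HeightOneSpectrum.uniformContinuous_algebraMap_liesOver K L
        (finiteBelow K w) w).continuous)).comp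
    (HeightOneSpectrum.adicCompletion.equiv K (finiteBelow K w)).toRingHom

/-- The local degree `[L_w : K_v]` at a prime `w` of `L`, where `v` is the prime of `K`
below `w`. -/
def degreeAbove : Place L → ℕ
  | .inl w =>
    letI := (finiteCompletionMap K w).toAlgebra
    Module.finrank ((finiteBelow K w).adicCompletion K) (w.adicCompletion L)
  | .inr w => Module.finrank (w.comap (algebraMap K L)).Completion w.Completion

end Below

section Above

variable {K : Type*} (L : Type*) [Field K] [NumberField K] [Field L] [NumberField L] [Algebra K L]

theorem exists_above (v : Place K) : ∃ w : Place L, w.below K = v := by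
  rcases v with v | v
  · obtain ⟨P, hP, hPv⟩ :=
      Ideal.exists_maximal_ideal_liesOver_of_isIntegral (S := 𝓞 L) v.asIdeal
    have hne : P ≠ ⊥ := Ideal.ne_bot_of_liesOver_of_ne_bot v.ne_bot P
    exact ⟨.inl ⟨P, hP.isPrime, hne⟩, congrArg Sum.inl (HeightOneSpectrum.ext hPv.over.symm)⟩
  · obtain ⟨w, hw⟩ := InfinitePlace.comap_surjective (K := L) v
    exact ⟨.inr w, congrArg Sum.inr hw⟩

/-- `n_v = [L_w : K_v]` for a prime `w` of `L` dividing `v`; in a Galois extension it does not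
depend on the choice of `w`. -/
def localDegree (v : Place K) : ℕ :=
  degreeAbove K (exists_above L v).choose

/-- The set of the primes of `L` that divide a prime in `S`. -/
def above (S : Set (Place K)) : Set (Place L) :=
  Place.below K ⁻¹' S

/-- The number `e_{L/K,S} = ∏_{v ∈ S} n_v · ∏_{v ∉ S} e(v)`, with `n_v` the local degree at `v` and
`e(v)` the ramification index of `v` in `L`. -/
def eNumber (S : Set (Place K)) : ℕ :=
  (∏ᶠ v : S, localDegree L (v : Place K)) *
    ∏ᶠ v : {v : HeightOneSpectrum (𝓞 K) // Sum.inl v ∉ S},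
      v.1.asIdeal.ramificationIdxIn (𝓞 L)

end Above

/-! ### `S`-ideals and `S`-ideal classes -/

section Ideals

variable {K : Type*} [Field K] [NumberField K]

variable (K) in
/-- The group `J_K` of the (nonzero) fractional ideals of `K`. -/
abbrev FracIdeal : Type _ := (FractionalIdeal (𝓞 K)⁰ K)ˣ

/-- A finite prime as a fractional ideal. -/
def primeIdeal (v : HeightOneSpectrum (𝓞 K)) : FracIdeal K :=
  Units.mk0 (v.asIdeal : FractionalIdeal (𝓞 K)⁰ K) (FractionalIdeal.coeIdeal_ne_zero.mpr v.ne_bot)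

/-- The group `J_{K,S}` of the fractional ideals of `K` generated by the primes outside `S`. -/
def sIdeals (S : Set (Place K)) : Subgroup (FracIdeal K) :=
  Subgroup.closure {I | ∃ v : HeightOneSpectrum (𝓞 K), Sum.inl v ∉ S ∧ primeIdeal v = I}

/-- A prime outside `S` as an element of `J_{K,S}`. -/
def sPrimeIdeal (S : Set (Place K)) (v : {v : HeightOneSpectrum (𝓞 K) // Sum.inl v ∉ S}) :
    sIdeals S :=
  ⟨primeIdeal v.1, Subgroup.subset_closure ⟨v.1, v.2, rfl⟩⟩

theorem finite_count (S : Set (Place K)) (I : FracIdeal K) :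
    (Function.mulSupport fun v : {v : HeightOneSpectrum (𝓞 K) // Sum.inl v ∉ S} =>
      sPrimeIdeal S v ^ FractionalIdeal.count K v.1 (I : FractionalIdeal (𝓞 K)⁰ K)).Finite := by
  have h := FractionalIdeal.finite_factors (I : FractionalIdeal (𝓞 K)⁰ K)
  rw [Filter.eventually_cofinite] at h
  refine (h.preimage (Subtype.val_injective.injOn)).subset fun v hv hv0 => hv ?_
  simp [hv0]

/-- The projection `J_K → J_{K,S}`, `∏_v v ^ a_v ↦ ∏_{v ∉ S} v ^ a_v`. -/
def sProj (S : Set (Place K)) : FracIdeal K →* sIdeals S where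
  toFun I := ∏ᶠ v : {v : HeightOneSpectrum (𝓞 K) // Sum.inl v ∉ S},
    sPrimeIdeal S v ^ FractionalIdeal.count K v.1 (I : FractionalIdeal (𝓞 K)⁰ K)
  map_one' := by simp [FractionalIdeal.count_one]
  map_mul' I J := by
    rw [← finprod_mul_distrib (finite_count S I) (finite_count S J)]
    refine finprod_congr fun v => ?_
    rw [Units.val_mul, FractionalIdeal.count_mul K v.1 I.ne_zero J.ne_zero, zpow_add]

theorem sProj_primeIdeal_of_notMem (S : Set (Place K)) (v : HeightOneSpectrum (𝓞 K))
    (hv : Sum.inl v ∉ S) : sProj S (primeIdeal v) = sPrimeIdeal S ⟨v, hv⟩ := by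
  refine (finprod_eq_single _ ⟨v, hv⟩ fun w hw => ?_).trans ?_
  · have hw' : v ≠ w.1 := fun h => hw (Subtype.ext h.symm)
    simp [primeIdeal, FractionalIdeal.count_maximal_coprime K w.1 hw']
  · simp [primeIdeal, FractionalIdeal.count_self]

theorem sProj_primeIdeal_of_mem (S : Set (Place K)) (v : HeightOneSpectrum (𝓞 K))
    (hv : Sum.inl v ∈ S) : sProj S (primeIdeal v) = 1 := by
  refine finprod_eq_one_of_forall_eq_one fun w => ?_
  have hw' : v ≠ w.1 := fun h => w.2 (h ▸ hv)
  simp [primeIdeal, FractionalIdeal.count_maximal_coprime K w.1 hw']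

theorem sProj_coe (S : Set (Place K)) (I : sIdeals S) : sProj S (I : FracIdeal K) = I := by
  obtain ⟨I, hI⟩ := I
  refine Subtype.ext ?_
  have : ∀ I ∈ sIdeals S, ((sProj S I : sIdeals S) : FracIdeal K) = I := by
    intro I hI
    induction hI using Subgroup.closure_induction with
    | mem x hx =>
      obtain ⟨v, hv, rfl⟩ := hx
      rw [sProj_primeIdeal_of_notMem S v hv]
      rfl
    | one => simp
    | mul x y _ _ hx hy => rw [map_mul, Subgroup.coe_mul, hx, hy]
    | inv x _ hx => rw [map_inv, Subgroup.coe_inv, hx]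
  exact this I hI

/-- The map `Kˣ → J_{K,S}`, which sends `α` to the projection of the principal ideal `(α)`. -/
def sPrincipal (S : Set (Place K)) : Kˣ →* sIdeals S :=
  (sProj S).comp (toPrincipalIdeal (𝓞 K) K)

/-- The `S`-ideal class group `Cl_{K,S}`, the cokernel of `Kˣ → J_{K,S}`. -/
abbrev SClassGroup (S : Set (Place K)) : Type _ :=
  sIdeals S ⧸ (sPrincipal S).range

instance finite_sClassGroup (S : Set (Place K)) : Finite (SClassGroup S) := by
  have : Finite (FracIdeal K ⧸ (toPrincipalIdeal (𝓞 K) K).range) :=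
    Finite.of_equiv _ (ClassGroup.equiv (R := 𝓞 K) K).toEquiv
  let f : FracIdeal K ⧸ (toPrincipalIdeal (𝓞 K) K).range →* SClassGroup S :=
    QuotientGroup.map _ _ (sProj S) (by rintro _ ⟨x, rfl⟩; exact ⟨x, rfl⟩)
  refine Finite.of_surjective f fun c => ?_
  obtain ⟨I, rfl⟩ := QuotientGroup.mk_surjective c
  refine ⟨QuotientGroup.mk (I : FracIdeal K), ?_⟩
  exact congrArg QuotientGroup.mk (sProj_coe S I)

theorem closure_primeIdeal :
    Subgroup.closure (Set.range (primeIdeal (K := K))) = ⊤ := by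
  refine (Subgroup.eq_top_iff' _).mpr fun I => ?_
  have h : ((sProj (∅ : Set (Place K)) I : sIdeals ∅) : FracIdeal K) = I := by
    apply Units.ext
    conv_rhs => rw [← FractionalIdeal.finprod_heightOneSpectrum_factorization' K I.ne_zero]
    have e : {v : HeightOneSpectrum (𝓞 K) // Sum.inl v ∉ (∅ : Set (Place K))} ≃
        HeightOneSpectrum (𝓞 K) := Equiv.subtypeUnivEquiv fun v => Set.notMem_empty _
    have := ((Units.coeHom _).comp (sIdeals (∅ : Set (Place K))).subtype).map_finprod
      (finite_count ∅ I)
    refine this.trans ?_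
    refine finprod_eq_of_bijective Subtype.val
      (Equiv.subtypeUnivEquiv fun v => Set.notMem_empty _).bijective fun v => ?_
    simp [sPrimeIdeal, primeIdeal]
  have hle : sIdeals (∅ : Set (Place K)) ≤ Subgroup.closure (Set.range (primeIdeal (K := K))) :=
    Subgroup.closure_mono (by rintro _ ⟨v, -, rfl⟩; exact ⟨v, rfl⟩)
  rw [← h]
  exact hle (SetLike.coe_mem _)

end Ideals

/-! ### The `S`-capitulation map -/

section Capitulation

variable {K : Type*} (L : Type*) [Field K] [NumberField K] [Field L] [NumberField L] [Algebra K L]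

/-- The extension `I ↦ I 𝓞_L` of fractional ideals from `K` to `L`. -/
def extend : FracIdeal K →* FracIdeal L :=
  Units.map (FractionalIdeal.extendedHom L (𝓞 L) :
    FractionalIdeal (𝓞 K)⁰ K →+* FractionalIdeal (𝓞 L)⁰ L).toMonoidHom

theorem extend_toPrincipalIdeal (x : Kˣ) :
    extend L (toPrincipalIdeal (𝓞 K) K x) =
      toPrincipalIdeal (𝓞 L) L (Units.map (algebraMap K L).toMonoidHom x) := by
  apply Units.ext
  have h : IsFractionRing.map (FaithfulSMul.algebraMap_injective (𝓞 K) (𝓞 L)) =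
      algebraMap K L := by
    refine IsLocalization.ringHom_ext (𝓞 K)⁰ (RingHom.ext fun a => ?_)
    simp [IsFractionRing.map, ← IsScalarTower.algebraMap_apply]
  simp only [extend, Units.coe_map, coe_toPrincipalIdeal]
  refine (FractionalIdeal.extendedHom_spanSingleton L (𝓞 L) (x : K)).trans ?_
  rw [h]
  rfl

theorem extend_primeIdeal_mem (v : HeightOneSpectrum (𝓞 K)) (T : Subgroup (FracIdeal L))
    (hT : ∀ w : HeightOneSpectrum (𝓞 L), finiteBelow K w = v → primeIdeal w ∈ T) :
    extend L (primeIdeal v) ∈ T := by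
  have key : ∀ J : Ideal (𝓞 L), J ≠ 0 →
      (∀ w : HeightOneSpectrum (𝓞 L), w.asIdeal ∣ J → primeIdeal w ∈ T) →
      ∀ u : FracIdeal L, (u : FractionalIdeal (𝓞 L)⁰ L) = J → u ∈ T := by
    intro J
    induction J using UniqueFactorizationMonoid.induction_on_prime with
    | h₁ => exact fun h => absurd rfl h
    | h₂ J hJ =>
      intro _ _ u hu
      have : u = 1 := by
        apply Units.ext
        rw [hu, isUnit_iff_eq_one.mp hJ]
        simp
      rw [this]
      exact T.one_mem
    | h₃ J P hJ hP ih =>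
      intro _ h u hu
      let w : HeightOneSpectrum (𝓞 L) := ⟨P, Ideal.isPrime_of_prime hP, hP.ne_zero⟩
      have hu' : u = primeIdeal w * Units.mk0 (J : FractionalIdeal (𝓞 L)⁰ L)
          (FractionalIdeal.coeIdeal_ne_zero.mpr hJ) := by
        apply Units.ext
        rw [hu]
        simp [primeIdeal, w]
      rw [hu']
      exact T.mul_mem (h w (dvd_mul_right _ _))
        (ih hJ (fun w' hw' => h w' (hw'.mul_left _)) _ rfl)
  refine key (v.asIdeal.map (algebraMap (𝓞 K) (𝓞 L))) ?_ (fun w hw => hT w ?_) _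
    (FractionalIdeal.extendedHom_coeIdeal_eq_map L (𝓞 L) v.asIdeal)
  · exact Ideal.map_ne_bot_of_ne_bot v.ne_bot
  · have h := (Ideal.liesOver_iff_dvd_map w.isPrime.ne_top).mpr hw
    exact HeightOneSpectrum.ext h.over.symm

theorem extend_mem (S : Set (Place K)) {I : FracIdeal K} (hI : I ∈ sIdeals S) :
    extend L I ∈ sIdeals (above L S) := by
  suffices h : sIdeals S ≤ (sIdeals (above L S)).comap (extend L) from h hI
  rw [sIdeals, Subgroup.closure_le]
  rintro _ ⟨v, hv, rfl⟩
  refine extend_primeIdeal_mem L v (sIdeals (above L S)) fun w hw =>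
    Subgroup.subset_closure ⟨w, ?_, rfl⟩
  subst hw
  exact hv

/-- The extension of ideals `J_{K,S} → J_{L,S}`. -/
def sExtend (S : Set (Place K)) : sIdeals S →* sIdeals (above L S) :=
  ((extend L).comp (sIdeals S).subtype).codRestrict _ fun I => extend_mem L S I.2

theorem sExtend_sProj (S : Set (Place K)) (I : FracIdeal K) :
    sExtend L S (sProj S I) = sProj (above L S) (extend L I) := by
  have h : (sExtend L S).comp (sProj S) = (sProj (above L S)).comp (extend L) := by
    refine MonoidHom.eq_of_eqOn_dense closure_primeIdeal ?_
    rintro _ ⟨v, rfl⟩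
    by_cases hv : Sum.inl v ∈ S
    · have h1 : extend L (primeIdeal v) ∈ (sProj (above L S)).ker := by
        refine extend_primeIdeal_mem L v _ fun w hw => ?_
        subst hw
        exact sProj_primeIdeal_of_mem _ w hv
      rw [MonoidHom.comp_apply, MonoidHom.comp_apply, sProj_primeIdeal_of_mem S v hv, map_one]
      exact h1.symm
    · rw [MonoidHom.comp_apply, MonoidHom.comp_apply, sProj_primeIdeal_of_notMem S v hv]
      exact (sProj_coe (above L S) (sExtend L S (sPrimeIdeal S ⟨v, hv⟩))).symm
  exact DFunLike.congr_fun h I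

/-- The `S`-capitulation map `Cl_{K,S} → Cl_{L,S}`, induced by the extension of ideals. -/
def capitulation (S : Set (Place K)) : SClassGroup S →* SClassGroup (above L S) :=
  QuotientGroup.map _ _ (sExtend L S) (by
    rintro _ ⟨x, rfl⟩
    refine ⟨Units.map (algebraMap K L).toMonoidHom x, ?_⟩
    change sProj _ _ = sExtend L S (sProj S _)
    rw [sExtend_sProj, extend_toPrincipalIdeal])

end Capitulation

end SCapitulation

end

noncomputable section

namespace SCapitulation

/-! ### Herbrand quotients -/

section Herbrand

variable {A B : Type*} [AddCommGroup A] [AddCommGroup B]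

/-! Let `σ` generate the Galois group, let `U` be the group of `S`-units of `L`, and let `P` be the
permutation module of integer functions on the primes of `L` above `S`. The order of `ker j` is
compared with `H⁻¹(U) = ker N / (σ - 1)U`, whose order the Herbrand quotient controls.

Herbrand quotient: there are elements of `U`, each concentrated at one prime above `S` and permuted
by Galois (`exists_equivariant_isConcentratedAt`). They embed `P` equivariantly and with finite
index into `ℤ × U`; the factor `ℤ` absorbs the single relation that the product formula imposes on
logarithms of units. Finite index does not change Herbrand quotients (`herbrand_eq`), and the
trivial module `ℤ` has Herbrand quotient `n`. Hence `|Ĥ⁰(P)| |H⁻¹(U)| = n |Ĥ⁰(U)| |H⁻¹(P)|`. As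
`|Ĥ⁰(P)|` divides the product of the orders of the decomposition groups, and these divide the local
degrees, `n` divides `∏ n_v · |H⁻¹(U)|` (`orderOf_dvd_prod_localDegree_mul_kerIndex`).

Capitulation: by Hilbert 90, `H⁻¹(U)` is `{x | σx/x ∈ U}` modulo `Kˣ U`, that is, the Galois
invariant principal `S`-ideals of `L` modulo those coming from `Kˣ`. In between lie the principal
`S`-ideals extended from `K`. The lower step is `ker j` (`card_ker_capitulation`); the upper one
embeds into `∏ ℤ/e(v)` over `v ∉ S` (`relIndex_dvd_prod_ramificationIdxIn`). So `n` divides `|ker j|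
· e_{L/K,S}`.

An infinite index counts as `0`. The identities are cross-multiplied and used as divisibilities, so
finiteness of the cohomology groups never has to be proved. -/

theorem relIndex_map_mul_relIndex_ker (f : A →+ B) {C D : AddSubgroup A} (h : C ≤ D) :
    (C.map f).relIndex (D.map f) * C.relIndex (D ⊓ f.ker) = C.relIndex D := by
  rw [← AddSubgroup.relIndex_comap, AddSubgroup.comap_map_eq, mul_comm]
  have h1 := AddSubgroup.relIndex_inf_mul_relIndex C (C ⊔ f.ker) D
  rwa [sup_inf_assoc_of_le _ h, AddSubgroup.relIndex_sup_left, inf_comm f.ker, inf_sup_self] at h1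

/-- The index of the image of `g` in the kernel of `f`. -/
def kerIndex (f g : A →+ A) : ℕ :=
  g.range.relIndex f.ker

/-- Both sides are the index of `φ (im g) = g' (im φ)` in `ker f'`, computed once through `φ (ker f)
= im φ ∩ ker f'` and once through `im g'`. -/
theorem kerIndex_mul_relIndex (φ : A →+ B) (hφ : Function.Injective φ)
    {f g : A →+ A} {f' g' : B →+ B} (hf : φ.comp f = f'.comp φ) (hg : φ.comp g = g'.comp φ)
    (hfg : f.comp g = 0) (hfg' : f'.comp g' = 0) :
    kerIndex f g * φ.range.relIndex f'.ker =
      kerIndex f' g' * (φ.range.map g').relIndex g'.range := by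
  have hf1 : ∀ x, φ (f x) = f' (φ x) := DFunLike.congr_fun hf
  have hker : f.ker.map φ = φ.range ⊓ f'.ker := by
    ext y
    constructor
    · rintro ⟨x, hx, rfl⟩
      refine ⟨⟨x, rfl⟩, ?_⟩
      change f' (φ x) = 0
      rw [← hf1, show f x = 0 from hx, map_zero]
    · rintro ⟨⟨x, rfl⟩, hx⟩
      refine ⟨x, hφ ?_, rfl⟩
      rw [hf1, map_zero]
      exact hx
  have hrange : g.range.map φ = φ.range.map g' := by
    rw [AddMonoidHom.map_range, AddMonoidHom.map_range, hg]
  have hle : g.range.map φ ≤ f.ker.map φ := by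
    refine AddSubgroup.map_mono ?_
    rintro _ ⟨x, rfl⟩
    exact DFunLike.congr_fun hfg x
  have hle' : g'.range ≤ f'.ker := by
    rintro _ ⟨x, rfl⟩
    exact DFunLike.congr_fun hfg' x
  have h1 := AddSubgroup.relIndex_mul_relIndex _ _ f'.ker hle (hker.trans_le inf_le_right)
  have h2 := AddSubgroup.relIndex_mul_relIndex (φ.range.map g') g'.range f'.ker
    (by rw [AddMonoidHom.range_eq_map g']; exact AddSubgroup.map_mono le_top) hle'
  rw [AddSubgroup.relIndex_map_map_of_injective _ _ hφ, hker, AddSubgroup.inf_relIndex_right,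
    hrange, ← h2] at h1
  rw [kerIndex, kerIndex, h1, mul_comm]

/-- The two correction factors, for `f'` and for `g'`, each multiply to the index of `im φ`. This
index is nonzero and cancels. -/
theorem herbrand_eq (φ : A →+ B) (hφ : Function.Injective φ) (hidx : φ.range.index ≠ 0)
    {f g : A →+ A} {f' g' : B →+ B} (hf : φ.comp f = f'.comp φ) (hg : φ.comp g = g'.comp φ)
    (hfg : f.comp g = 0) (hfg' : f'.comp g' = 0) (hgf : g.comp f = 0) (hgf' : g'.comp f' = 0) :
    kerIndex f g * kerIndex g' f' = kerIndex f' g' * kerIndex g f := by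
  have h1 := kerIndex_mul_relIndex φ hφ hf hg hfg hfg'
  have h2 := kerIndex_mul_relIndex φ hφ hg hf hgf hgf'
  have h3 := relIndex_map_mul_relIndex_ker f' (le_top : φ.range ≤ ⊤)
  have h4 := relIndex_map_mul_relIndex_ker g' (le_top : φ.range ≤ ⊤)
  rw [top_inf_eq, ← AddMonoidHom.range_eq_map, AddSubgroup.relIndex_top_right] at h3 h4
  refine mul_right_cancel₀ hidx ?_
  calc kerIndex f g * kerIndex g' f' * φ.range.index
      = kerIndex f g * φ.range.relIndex f'.ker *
          (kerIndex g' f' * (φ.range.map f').relIndex f'.range) := by rw [← h3]; ring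
    _ = kerIndex f' g' * (φ.range.map g').relIndex g'.range *
          (kerIndex g f * φ.range.relIndex g'.ker) := by rw [h1, h2]
    _ = kerIndex f' g' * kerIndex g f * φ.range.index := by rw [← h4]; ring

/-- The endomorphism `s - 1`. -/
def diffEnd (s : AddMonoid.End A) : A →+ A :=
  (s - 1 : AddMonoid.End A)

/-- The endomorphism `1 + s + ⋯ + s ^ (n - 1)`. -/
def normEnd (s : AddMonoid.End A) (n : ℕ) : A →+ A :=
  (∑ i ∈ Finset.range n, s ^ i : AddMonoid.End A)

theorem diffEnd_apply (s : AddMonoid.End A) (x : A) : diffEnd s x = s x - x := rfl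

theorem normEnd_apply (s : AddMonoid.End A) (n : ℕ) (x : A) :
    normEnd s n x = ∑ i ∈ Finset.range n, s^[i] x := by
  refine (AddMonoidHom.finsetSum_apply _ _ _).trans (Finset.sum_congr rfl fun i _ => ?_)
  exact congrFun (AddMonoid.End.coe_pow _ s i) x

theorem diffEnd_comp_normEnd {s : AddMonoid.End A} {n : ℕ} (hs : s ^ n = 1) :
    (diffEnd s).comp (normEnd s n) = 0 := by
  have : (s - 1) * ∑ i ∈ Finset.range n, s ^ i = 0 := by rw [mul_geom_sum, hs, sub_self]
  exact this

theorem normEnd_comp_diffEnd {s : AddMonoid.End A} {n : ℕ} (hs : s ^ n = 1) :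
    (normEnd s n).comp (diffEnd s) = 0 := by
  have : (∑ i ∈ Finset.range n, s ^ i) * (s - 1) = 0 := by rw [geom_sum_mul, hs, sub_self]
  exact this

theorem comp_diffEnd {φ : A →+ B} {s : AddMonoid.End A} {t : AddMonoid.End B}
    (h : ∀ x, φ (s x) = t (φ x)) : φ.comp (diffEnd s) = (diffEnd t).comp φ := by
  ext x
  simp [diffEnd_apply, h]

theorem comp_normEnd {φ : A →+ B} {s : AddMonoid.End A} {t : AddMonoid.End B}
    (h : ∀ x, φ (s x) = t (φ x)) (n : ℕ) : φ.comp (normEnd s n) = (normEnd t n).comp φ := by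
  ext x
  simp [normEnd_apply, fun i => (Function.Semiconj.iterate_right h i).eq x]

/-- The endomorphism of `ℤ × A` that is the identity on `ℤ` and `s` on `A`. -/
def prodEnd (s : AddMonoid.End A) : AddMonoid.End (ℤ × A) :=
  (AddMonoidHom.id ℤ).prodMap s

theorem prodEnd_iterate (s : AddMonoid.End A) (i : ℕ) (x : ℤ × A) :
    (prodEnd s)^[i] x = (x.1, s^[i] x.2) := by
  induction i generalizing x with
  | zero => rfl
  | succ i ih =>
    rw [Function.iterate_succ_apply, Function.iterate_succ_apply]
    exact ih _

theorem prodEnd_pow {s : AddMonoid.End A} {n : ℕ} (hs : s ^ n = 1) : prodEnd s ^ n = 1 := by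
  have h : ∀ x, s^[n] x = x := fun x => by
    rw [← AddMonoid.End.coe_pow, hs]
    rfl
  refine DFunLike.ext _ _ fun x => ?_
  rw [AddMonoid.End.coe_pow, prodEnd_iterate, h]
  rfl

theorem diffEnd_prodEnd (s : AddMonoid.End A) :
    diffEnd (prodEnd s) = (0 : ℤ →+ ℤ).prodMap (diffEnd s) := by
  refine DFunLike.ext _ _ fun x => ?_
  rw [diffEnd_apply]
  exact Prod.ext (sub_self _) rfl

theorem normEnd_prodEnd (s : AddMonoid.End A) (n : ℕ) :
    normEnd (prodEnd s) n = (n • AddMonoidHom.id ℤ).prodMap (normEnd s n) := by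
  refine DFunLike.ext _ _ fun x => ?_
  rw [normEnd_apply]
  simp_rw [prodEnd_iterate]
  refine Prod.ext ?_ ?_
  · simp [Prod.fst_sum]
  · simp [Prod.snd_sum, normEnd_apply]

theorem relIndex_prod (H K : AddSubgroup A) (H' K' : AddSubgroup B) :
    (H.prod H').relIndex (K.prod K') = H.relIndex K * H'.relIndex K' := by
  have h := AddSubgroup.index_comap (H.prod H') (K.subtype.prodMap K'.subtype)
  rw [AddMonoidHom.range_prodMap, AddSubgroup.range_subtype, AddSubgroup.range_subtype] at h
  rw [← h, AddSubgroup.relIndex, AddSubgroup.relIndex, ← AddSubgroup.index_prod]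
  rfl

theorem kerIndex_prodMap (f g : A →+ A) (f' g' : B →+ B) :
    kerIndex (f.prodMap f') (g.prodMap g') = kerIndex f g * kerIndex f' g' := by
  rw [kerIndex, AddMonoidHom.ker_prodMap, AddMonoidHom.range_prodMap, relIndex_prod]
  rfl

/-- For the trivial module `ℤ`, `σ - 1` is `0` and the norm is multiplication by `n`, so `Ĥ⁰ = ℤ/n`.
The companion below uses `H⁻¹ = 0`. -/
theorem kerIndex_prod_diff_norm (s : AddMonoid.End A) (n : ℕ) :
    kerIndex (diffEnd (prodEnd s)) (normEnd (prodEnd s) n) =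
      n * kerIndex (diffEnd s) (normEnd s n) := by
  rw [diffEnd_prodEnd, normEnd_prodEnd, kerIndex_prodMap]
  congr 1
  have h : (n • AddMonoidHom.id ℤ).range = AddSubgroup.zmultiples (n : ℤ) := by
    ext x
    simp [Int.mem_zmultiples_iff, dvd_def, eq_comm]
  rw [kerIndex, AddMonoidHom.ker_zero, AddSubgroup.relIndex_top_right, h,
    Int.index_zmultiples, Int.natAbs_natCast]

theorem kerIndex_prod_norm_diff (s : AddMonoid.End A) {n : ℕ} (hn : n ≠ 0) :
    kerIndex (normEnd (prodEnd s) n) (diffEnd (prodEnd s)) =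
      kerIndex (normEnd s n) (diffEnd s) := by
  rw [diffEnd_prodEnd, normEnd_prodEnd, kerIndex_prodMap]
  have h : (n • AddMonoidHom.id ℤ).ker = ⊥ := by
    rw [AddMonoidHom.ker_eq_bot_iff]
    exact fun x y h => by simpa [hn] using h
  rw [kerIndex, h, AddSubgroup.relIndex_bot_right, one_mul]

/-- If a module `M` embeds with finite index into `ℤ × A`, then the Herbrand quotient of `M` is
`n` times that of `A`. -/
theorem herbrand_mul_eq {M : Type*} [AddCommGroup M] {n : ℕ} (hn : n ≠ 0)
    {s : AddMonoid.End A} (hs : s ^ n = 1) {t : AddMonoid.End M} (ht : t ^ n = 1)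
    (φ : M →+ ℤ × A) (hφ : Function.Injective φ) (hidx : φ.range.index ≠ 0)
    (h : ∀ x, φ (t x) = prodEnd s (φ x)) :
    kerIndex (diffEnd t) (normEnd t n) * kerIndex (normEnd s n) (diffEnd s) =
      n * kerIndex (diffEnd s) (normEnd s n) * kerIndex (normEnd t n) (diffEnd t) := by
  rw [← kerIndex_prod_diff_norm, ← kerIndex_prod_norm_diff s hn]
  have hp := prodEnd_pow hs
  exact herbrand_eq φ hφ hidx (comp_diffEnd h) (comp_normEnd h n) (diffEnd_comp_normEnd ht)
    (diffEnd_comp_normEnd hp) (normEnd_comp_diffEnd ht) (normEnd_comp_diffEnd hp)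

end Herbrand

/-! ### Permutation modules -/

section Permutation

variable {G T S : Type*} [Group G] [MulAction G T]

/-- The action of `σ` on the functions `T → ℤ`. -/
def permEnd (T : Type*) [MulAction G T] (σ : G) : AddMonoid.End (T → ℤ) where
  toFun f t := f (σ⁻¹ • t)
  map_zero' := rfl
  map_add' _ _ := rfl

theorem permEnd_apply (σ : G) (f : T → ℤ) (t : T) : permEnd T σ f t = f (σ⁻¹ • t) := rfl

theorem permEnd_iterate (σ : G) (i : ℕ) (f : T → ℤ) (t : T) :
    (permEnd T σ)^[i] f t = f ((σ ^ i)⁻¹ • t) := by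
  induction i generalizing f with
  | zero => simp
  | succ i ih =>
    rw [Function.iterate_succ_apply, ih, permEnd_apply, ← mul_smul, ← mul_inv_rev, pow_succ]

theorem permEnd_pow_orderOf (σ : G) : permEnd T σ ^ orderOf σ = 1 := by
  refine DFunLike.ext _ _ fun f => funext fun t => ?_
  rw [AddMonoid.End.coe_pow, permEnd_iterate, pow_orderOf_eq_one, inv_one, one_smul]
  rfl

theorem sum_range_orderOf [Fintype G] {σ : G} (hσ : ∀ g, g ∈ Subgroup.zpowers σ)
    {M : Type*} [AddCommMonoid M] (F : G → M) :
    ∑ i ∈ Finset.range (orderOf σ), F (σ ^ i) = ∑ g, F g := by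
  classical
  rw [← IsCyclic.image_range_orderOf hσ, Finset.sum_image]
  exact fun i hi j hj h => pow_injOn_Iio_orderOf (by simpa using hi) (by simpa using hj) h

/-- An invariant function is determined by its values at the orbit representatives `b s`, and it is
a norm once each value is divisible by the order of the stabilizer. So `Ĥ⁰` is a quotient of a
subgroup of the product of the groups `ZMod (d s)`. -/
theorem kerIndex_permEnd_dvd [Finite G] {σ : G} (hσ : ∀ g, g ∈ Subgroup.zpowers σ)
    [Fintype S] (p : T → S) (b : S → T)
    (hp : ∀ (g : G) t, p (g • t) = p t) (htrans : ∀ t, ∃ g : G, g • b (p t) = t) :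
    kerIndex (diffEnd (permEnd T σ)) (normEnd (permEnd T σ) (orderOf σ)) ∣
      ∏ s, Nat.card (MulAction.stabilizer G (b s)) := by
  classical
  have := Fintype.ofFinite G
  let d : S → ℕ := fun s => Nat.card (MulAction.stabilizer G (b s))
  let Ψ : (T → ℤ) →+ ∀ s, ZMod (d s) :=
    AddMonoidHom.pi fun s => (Int.castAddHom (ZMod (d s))).comp (Pi.evalAddMonoidHom _ (b s))
  have hcard : Nat.card (∀ s, ZMod (d s)) = ∏ s, d s := by
    rw [Nat.card_pi]
    exact Finset.prod_congr rfl fun s _ => Nat.card_zmod _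
  set I := (diffEnd (permEnd T σ)).ker
  have hle : Ψ.ker ⊓ I ≤ (normEnd (permEnd T σ) (orderOf σ)).range := by
    rintro f ⟨hfΨ, hfI⟩
    have hinv : ∀ (g : G) t, f (g • t) = f t := by
      have hσf : permEnd T σ f = f := sub_eq_zero.mp hfI
      intro g t
      obtain ⟨i, rfl⟩ : ∃ i : ℕ, σ ^ i = g := by
        obtain ⟨i, hi⟩ := (mem_powers_iff_mem_zpowers.mpr (hσ g))
        exact ⟨i, hi⟩
      have := permEnd_iterate σ i f (σ ^ i • t)
      rwa [Function.iterate_fixed hσf, inv_smul_smul] at this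
    have hdvd : ∀ s, ∃ c, f (b s) = d s * c := fun s =>
      (ZMod.intCast_zmod_eq_zero_iff_dvd _ _).mp (congrFun hfΨ s)
    choose c hc using hdvd
    -- The preimage lives on the representatives only. At `t` its norm counts `c (p t)` once for
    -- each `g` carrying `b (p t)` to `t`, and these `g` form a coset of the stabilizer.
    refine ⟨fun t => if t = b (p t) then c (p t) else 0, funext fun t => ?_⟩
    obtain ⟨g₀, hg₀⟩ := htrans t
    have hcount : Nat.card {g : G // g⁻¹ • t = b (p t)} = d (p t) := by
      refine Nat.card_congr ((Equiv.inv G).trans (Equiv.mulRight g₀) |>.subtypeEquiv fun g => ?_)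
      simp [MulAction.mem_stabilizer_iff, mul_smul, hg₀]
    rw [normEnd_apply, Finset.sum_apply]
    simp_rw [permEnd_iterate, hp]
    rw [sum_range_orderOf hσ (fun g => if g⁻¹ • t = b (p t) then c (p t) else 0),
      Finset.sum_ite, Finset.sum_const_zero, add_zero, Finset.sum_const, nsmul_eq_mul,
      ← Fintype.card_subtype, ← Nat.card_eq_fintype_card, hcount, ← hc, ← hinv g₀ (b (p t)), hg₀]
  have h1 := AddSubgroup.relIndex_dvd_of_le_left I hle
  rw [AddSubgroup.inf_relIndex_right, AddSubgroup.relIndex_ker] at h1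
  refine h1.trans ?_
  rw [← hcard]
  exact AddSubgroup.card_addSubgroup_dvd_card _

/-- The homomorphism `(T → ℤ) → A` with values `ε` on the standard basis. -/
def linComb [Fintype T] {A : Type*} [AddCommGroup A] (ε : T → A) : (T → ℤ) →+ A where
  toFun f := ∑ t, f t • ε t
  map_zero' := by simp
  map_add' f g := by simp [add_smul, Finset.sum_add_distrib]

theorem linComb_permEnd [Fintype T] {A : Type*} [AddCommGroup A] (ε : T → A) (σ : G)
    (s : AddMonoid.End A) (hε : ∀ t, ε (σ • t) = s (ε t)) (f : T → ℤ) :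
    linComb ε (permEnd T σ f) = s (linComb ε f) := by
  refine Eq.trans ?_ (map_sum s _ _).symm
  refine (Equiv.sum_comp (MulAction.toPerm σ) _).symm.trans (Finset.sum_congr rfl fun t _ => ?_)
  rw [MulAction.toPerm_apply, permEnd_apply, inv_smul_smul, hε, map_zsmul]

end Permutation

open NumberField IsDedekindDomain

/-! ### Units and the infinite primes -/

section ArchimedeanUnits

/-- A sign argument: over the columns where `c` is positive, the partial sum of row `i` is positive
when `c i > 0` and nonpositive otherwise. Weighting by `c` then gives a strictly positive number
that should vanish. In the application `a` is the matrix of logarithms of units, with row sums zero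
by the product formula. -/
theorem eq_zero_of_sum_eq_zero_of_sum_mul_eq_zero {ι : Type*} [Fintype ι] {a : ι → ι → ℝ}
    (ha : ∀ i j, i ≠ j → a i j < 0) (hsum : ∀ i, ∑ j, a i j = 0) {c : ι → ℝ}
    (hc : ∑ i, c i = 0) (hca : ∀ j, ∑ i, c i * a i j = 0) : c = 0 := by
  classical
  by_contra hne
  obtain ⟨i₀, -, hi₀⟩ := Finset.exists_pos_of_sum_zero_of_exists_nonzero c hc
    (by simpa using Function.ne_iff.mp hne)
  obtain ⟨j₀, -, hj₀⟩ := Finset.exists_pos_of_sum_zero_of_exists_nonzero (fun i => - c i)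
    (by simpa using hc) (by simpa using Function.ne_iff.mp hne)
  let P : Finset ι := Finset.univ.filter fun i => 0 < c i
  have hj₀P : j₀ ∈ Pᶜ := by simp [P]; linarith
  have hpos : ∀ i ∈ P, 0 < ∑ j ∈ P, a i j := fun i hi => by
    have h := Finset.sum_add_sum_compl P (a i)
    rw [hsum] at h
    have : ∑ j ∈ Pᶜ, a i j < 0 := Finset.sum_neg
      (fun j hj => ha i j fun h => (Finset.mem_compl.mp hj) (h ▸ hi)) ⟨j₀, hj₀P⟩
    linarith
  have hneg : ∀ i ∉ P, ∑ j ∈ P, a i j ≤ 0 := fun i hi =>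
    Finset.sum_nonpos fun j hj => (ha i j fun h => hi (h ▸ hj)).le
  have hzero : ∑ i, c i * ∑ j ∈ P, a i j = 0 := by
    simp_rw [Finset.mul_sum]
    rw [Finset.sum_comm]
    exact Finset.sum_eq_zero fun j _ => hca j
  have hi₀P : i₀ ∈ P := by simpa [P] using hi₀
  refine hzero.not_gt (Finset.sum_pos' (fun i _ => ?_) ⟨i₀, Finset.mem_univ _, ?_⟩)
  · by_cases hi : i ∈ P
    · exact mul_nonneg (by simpa [P] using hi : 0 < c i).le (hpos i hi).le
    · exact mul_nonneg_of_nonpos_of_nonpos (by simpa [P] using hi) (hneg i hi)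
  · exact mul_pos hi₀ (hpos i₀ hi₀P)

variable {L : Type*} [Field L] [NumberField L]

theorem eq_zero_of_linComb_units_eq_zero {ε : InfinitePlace L → Additive (𝓞 L)ˣ}
    (hε : ∀ w w' : InfinitePlace L, w ≠ w' → Real.log (w' ((ε w).toMul : L)) < 0)
    {c : InfinitePlace L → ℤ}
    (hc : ∑ w, c w = 0) (h : linComb ε c = 0) : c = 0 := by
  have key := eq_zero_of_sum_eq_zero_of_sum_mul_eq_zero
    (a := fun w w' : InfinitePlace L => w'.mult * Real.log (w' ((ε w).toMul : L)))
    (c := fun w => (c w : ℝ))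
    (fun w w' hw => mul_neg_of_pos_of_neg (by exact_mod_cast w'.mult_pos) (hε w w' hw))
    (fun w => Units.sum_mult_mul_log _) (by exact_mod_cast hc) (fun w' => ?_)
  · funext w
    exact Int.cast_eq_zero.mp (congrFun key w)
  · let ℓ : Additive (𝓞 L)ˣ →+ ℝ :=
      { toFun := fun u => w'.mult * Real.log (w' ((u.toMul : (𝓞 L)ˣ) : L))
        map_zero' := by simp
        map_add' := fun u v => by
          have hu : w' ((u.toMul : (𝓞 L)ˣ) : L) ≠ 0 := by simp
          have hv : w' ((v.toMul : (𝓞 L)ˣ) : L) ≠ 0 := by simp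
          simp only [toMul_add, Units.coe_mul, map_mul]
          rw [Real.log_mul hu hv, mul_add] }
    have := congrArg ℓ h
    rw [map_zero] at this
    rw [← this]
    refine Eq.trans ?_ (map_sum ℓ _ _).symm
    refine Finset.sum_congr rfl fun w _ => ?_
    rw [map_zsmul, zsmul_eq_mul]
    rfl

/-- The homomorphism `f ↦ (∑ f, ∑ f w • ε w)`. -/
def sumLinComb {T A : Type*} [Fintype T] [AddCommGroup A] (ε : T → A) : (T → ℤ) →+ ℤ × A :=
  (linComb (fun _ => (1 : ℤ))).prod (linComb ε)

theorem sumLinComb_units_injective {ε : InfinitePlace L → Additive (𝓞 L)ˣ}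
    (hε : ∀ w w' : InfinitePlace L, w ≠ w' → Real.log (w' ((ε w).toMul : L)) < 0) :
    Function.Injective (sumLinComb ε) := by
  refine (injective_iff_map_eq_zero _).mpr fun c hc => ?_
  refine eq_zero_of_linComb_units_eq_zero hε ?_ (congrArg Prod.snd hc)
  simpa [sumLinComb, linComb] using congrArg Prod.fst hc

/-- By Dirichlet's theorem `ℤ × 𝓞_Lˣ` has rank equal to the number of infinite primes. An injective
map from a free module of that rank has torsion cokernel. -/
theorem exists_zsmul_mem_range_sumLinComb_units {ε : InfinitePlace L → Additive (𝓞 L)ˣ}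
    (hε : ∀ w w' : InfinitePlace L, w ≠ w' → Real.log (w' ((ε w).toMul : L)) < 0)
    (x : ℤ × Additive (𝓞 L)ˣ) :
    ∃ k : ℤ, k ≠ 0 ∧ k • x ∈ (sumLinComb ε).range := by
  let φ := (sumLinComb ε).toIntLinearMap
  have hφ : Function.Injective φ := sumLinComb_units_injective hε
  have hrange : Module.finrank ℤ (LinearMap.range φ) = Fintype.card (InfinitePlace L) := by
    rw [LinearMap.finrank_range_of_inj hφ, Module.finrank_fintype_fun_eq_card]
  have htot : Module.finrank ℤ (ℤ × Additive (𝓞 L)ˣ) = Fintype.card (InfinitePlace L) := by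
    have hq := Submodule.finrank_quotient_add_finrank
      (LinearMap.ker (LinearMap.snd ℤ ℤ (Additive (𝓞 L)ˣ)))
    rw [(LinearMap.quotKerEquivOfSurjective _ LinearMap.snd_surjective).finrank_eq,
      ← LinearMap.range_inl, LinearMap.finrank_range_of_inj LinearMap.inl_injective,
      Module.finrank_self, Units.finrank_eq, Units.rank] at hq
    -- The unit rank is a truncated difference `card - 1`; positivity makes adding the factor `ℤ`
    -- give back exactly `card`.
    have : 0 < Fintype.card (InfinitePlace L) := Fintype.card_pos
    omega
  have h0 := Submodule.finrank_quotient_add_finrank (LinearMap.range φ)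
  have h1 : Module.finrank ℤ ((ℤ × Additive (𝓞 L)ˣ) ⧸ LinearMap.range φ) = 0 := by omega
  rw [Module.finrank_eq_zero_iff_isTorsion] at h1
  obtain ⟨⟨k, hk⟩, hkx⟩ := @h1 (Submodule.Quotient.mk x)
  refine ⟨k, nonZeroDivisors.ne_zero hk, ?_⟩
  have := (Submodule.Quotient.mk_eq_zero (LinearMap.range φ)).mp
    ((Submodule.Quotient.mk_smul (LinearMap.range φ) k x).trans hkx)
  exact this

end ArchimedeanUnits

/-! ### Orders of fractional ideals at finite primes -/

section Orders

variable {K : Type*} [Field K] [NumberField K]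

/-- The exponent of `v` in a fractional ideal. -/
def idealOrd (v : HeightOneSpectrum (𝓞 K)) : FracIdeal K →* Multiplicative ℤ where
  toFun I := .ofAdd (FractionalIdeal.count K v (I : FractionalIdeal (𝓞 K)⁰ K))
  map_one' := by simp [FractionalIdeal.count_one]
  map_mul' I J := by
    rw [Units.val_mul, FractionalIdeal.count_mul K v I.ne_zero J.ne_zero, ofAdd_add]

/-- The exponent of `v` in the principal fractional ideal generated by `x`. -/
def ord (v : HeightOneSpectrum (𝓞 K)) : Kˣ →* Multiplicative ℤ :=
  (idealOrd v).comp (toPrincipalIdeal (𝓞 K) K)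

theorem idealOrd_primeIdeal_self (v : HeightOneSpectrum (𝓞 K)) :
    idealOrd v (primeIdeal v) = .ofAdd 1 := by
  simp [idealOrd, primeIdeal, FractionalIdeal.count_self]

theorem idealOrd_primeIdeal_of_ne {v w : HeightOneSpectrum (𝓞 K)} (h : w ≠ v) :
    idealOrd v (primeIdeal w) = 1 := by
  simp [idealOrd, primeIdeal, FractionalIdeal.count_maximal_coprime K v h]

theorem idealOrd_ext {I J : FracIdeal K} (h : ∀ v, idealOrd v I = idealOrd v J) : I = J := by
  apply Units.ext
  rw [← FractionalIdeal.finprod_heightOneSpectrum_factorization' K I.ne_zero,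
    ← FractionalIdeal.finprod_heightOneSpectrum_factorization' K J.ne_zero]
  exact finprod_congr fun v => congrArg _ (Multiplicative.ofAdd.injective (h v))

theorem idealOrd_sProj_of_notMem {S : Set (Place K)} {v : HeightOneSpectrum (𝓞 K)}
    (hv : Sum.inl v ∉ S) (I : FracIdeal K) :
    idealOrd v (sProj S I : FracIdeal K) = idealOrd v I := by
  suffices h : ((idealOrd v).comp (sIdeals S).subtype).comp (sProj S) = idealOrd v from
    DFunLike.congr_fun h I
  refine MonoidHom.eq_of_eqOn_dense closure_primeIdeal ?_
  rintro _ ⟨w, rfl⟩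
  simp only [MonoidHom.comp_apply]
  by_cases hw : Sum.inl w ∈ S
  · rw [sProj_primeIdeal_of_mem S w hw, map_one, map_one, idealOrd_primeIdeal_of_ne]
    rintro rfl
    exact hv hw
  · rw [sProj_primeIdeal_of_notMem S w hw]
    rfl

theorem idealOrd_eq_one_of_mem_sIdeals {S : Set (Place K)} {v : HeightOneSpectrum (𝓞 K)}
    (hv : Sum.inl v ∈ S) {I : FracIdeal K} (hI : I ∈ sIdeals S) : idealOrd v I = 1 := by
  suffices h : sIdeals S ≤ (idealOrd v).ker from h hI
  rw [sIdeals, Subgroup.closure_le]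
  rintro _ ⟨w, hw, rfl⟩
  refine idealOrd_primeIdeal_of_ne ?_
  rintro rfl
  exact hw hv

theorem sIdeals_ext {S : Set (Place K)} {I J : sIdeals S}
    (h : ∀ v, Sum.inl v ∉ S → idealOrd v (I : FracIdeal K) = idealOrd v (J : FracIdeal K)) :
    I = J := by
  refine Subtype.ext (idealOrd_ext fun v => ?_)
  by_cases hv : Sum.inl v ∈ S
  · rw [idealOrd_eq_one_of_mem_sIdeals hv I.2, idealOrd_eq_one_of_mem_sIdeals hv J.2]
  · exact h v hv

theorem mem_ker_sPrincipal {S : Set (Place K)} {x : Kˣ} :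
    x ∈ (sPrincipal S).ker ↔ ∀ v, Sum.inl v ∉ S → ord v x = 1 := by
  refine ⟨fun h v hv => ?_, fun h => sIdeals_ext fun v hv => ?_⟩
  · rw [ord, MonoidHom.comp_apply, ← idealOrd_sProj_of_notMem hv]
    exact (congrArg (fun I : sIdeals S => idealOrd v (I : FracIdeal K)) h).trans (map_one _)
  · rw [Subgroup.coe_one, map_one, ← h v hv]
    exact idealOrd_sProj_of_notMem hv _

theorem idealOrd_coeIdeal (v : HeightOneSpectrum (𝓞 K)) {u : FracIdeal K} {J : Ideal (𝓞 K)}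
    (hJ : J ≠ ⊥) (hu : (u : FractionalIdeal (𝓞 K)⁰ K) = J) :
    idealOrd v u = .ofAdd (multiplicity v.asIdeal J : ℤ) := by
  classical
  change Multiplicative.ofAdd _ = _
  rw [hu, FractionalIdeal.count_coe K v hJ,
    Ideal.count_associates_factors_eq hJ v.isPrime v.ne_bot,
    HeightOneSpectrum.count_normalizedFactors_eq_multiplicity hJ]

theorem valuation_eq_exp_neg_ord (v : HeightOneSpectrum (𝓞 K)) (x : Kˣ) :
    v.valuation K (x : K) = WithZero.exp (-(ord v x).toAdd) := by
  have key : ∀ (a : 𝓞 K) (u : Kˣ), (u : K) = a →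
      v.valuation K (u : K) = WithZero.exp (-(ord v u).toAdd) := by
    intro a u hu
    have ha : a ≠ 0 := by
      rintro rfl
      exact u.ne_zero (hu.trans (map_zero _))
    rw [hu, HeightOneSpectrum.valuation_of_algebraMap,
      HeightOneSpectrum.intValuation_eq_exp_neg_multiplicity v ha, ord, MonoidHom.comp_apply,
      idealOrd_coeIdeal v (J := Ideal.span {a}) (by simpa using ha)]
    · rfl
    · rw [coe_toPrincipalIdeal, hu, FractionalIdeal.coeIdeal_span_singleton]
  obtain ⟨a, b, hb, hx⟩ := IsFractionRing.div_surjective (A := 𝓞 K) (x : K)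
  have hb0 : algebraMap (𝓞 K) K b ≠ 0 := by simpa using nonZeroDivisors.ne_zero hb
  have ha0 : algebraMap (𝓞 K) K a ≠ 0 := by
    intro h
    rw [h, zero_div] at hx
    exact x.ne_zero hx.symm
  have hx' : x = Units.mk0 _ ha0 / Units.mk0 _ hb0 := Units.ext (by simp [hx])
  rw [hx', map_div, Units.val_div_eq_div_val, map_div₀, key a _ rfl, key b _ rfl, toAdd_div,
    ← WithZero.exp_sub]
  congr 1
  ring

end Orders

/-! ### Extension of ideals multiplies orders by ramification indices. -/

section Extension

variable {K : Type*} (L : Type*) [Field K] [NumberField K] [Field L] [NumberField L] [Algebra K L]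

theorem idealOrd_extend [IsGalois K L] (w : HeightOneSpectrum (𝓞 L)) (I : FracIdeal K) :
    idealOrd w (extend L I) =
      idealOrd (finiteBelow K w) I ^ (finiteBelow K w).asIdeal.ramificationIdxIn (𝓞 L) := by
  suffices h : (idealOrd w).comp (extend L) = (powMonoidHom
      ((finiteBelow K w).asIdeal.ramificationIdxIn (𝓞 L))).comp (idealOrd (finiteBelow K w)) from
    DFunLike.congr_fun h I
  refine MonoidHom.eq_of_eqOn_dense closure_primeIdeal ?_
  rintro _ ⟨v, rfl⟩
  have hmap : v.asIdeal.map (algebraMap (𝓞 K) (𝓞 L)) ≠ ⊥ := Ideal.map_ne_bot_of_ne_bot v.ne_bot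
  have hmult := Ideal.IsDedekindDomain.emultiplicity_map_eq_ramificationIdx'_mul (S := 𝓞 L)
    (v := (finiteBelow K w).asIdeal) (w := w.asIdeal) v.ne_bot (finiteBelow K w).irreducible
    w.irreducible w.ne_bot
  rw [Ideal.ramificationIdx'_eq_ramificationIdx _ _ (finiteBelow K w).ne_bot,
    ← Ideal.ramificationIdxIn_eq_ramificationIdx (finiteBelow K w).asIdeal w.asIdeal Gal(L/K),
    (FiniteMultiplicity.of_prime_left w.prime hmap).emultiplicity_eq_multiplicity,
    (FiniteMultiplicity.of_prime_left (finiteBelow K w).prime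
      v.ne_bot).emultiplicity_eq_multiplicity] at hmult
  simp only [MonoidHom.comp_apply, powMonoidHom_apply]
  rw [idealOrd_coeIdeal w hmap (FractionalIdeal.extendedHom_coeIdeal_eq_map L (𝓞 L) v.asIdeal),
    idealOrd_coeIdeal (finiteBelow K w) v.ne_bot rfl, ← ofAdd_nsmul, nsmul_eq_mul]
  congr 1
  exact_mod_cast hmult

/-- Ramification indices are nonzero, so the exponents of an ideal can be read off from its
extension. This lets `ker j` be computed inside `J_{L,S}`. -/
theorem sExtend_injective [IsGalois K L] (S : Set (Place K)) :
    Function.Injective (sExtend L S) := by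
  refine (injective_iff_map_eq_one _).mpr fun I hI => sIdeals_ext fun v hv => ?_
  obtain ⟨w | w, hw⟩ := exists_above L (Sum.inl v : Place K)
  · obtain rfl : finiteBelow K w = v := Sum.inl_injective hw
    have h := idealOrd_extend L w (I : FracIdeal K)
    have h1 : extend L (I : FracIdeal K) = 1 := congrArg Subtype.val hI
    rw [h1, map_one, eq_comm, pow_eq_one_iff_left] at h
    · rw [h, Subgroup.coe_one, map_one]
    · exact Ideal.ramificationIdxIn_ne_zero Gal(L/K)
  · exact absurd hw (by simp [Place.below])

end Extension

/-! ### The Galois action -/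

section Galois

variable {K L : Type*} [Field K] [Field L] [NumberField L] [Algebra K L]

open Pointwise in
instance : MulAction Gal(L/K) (HeightOneSpectrum (𝓞 L)) where
  smul σ w := ⟨σ • w.asIdeal, inferInstance, fun h => w.ne_bot (by
    rw [← inv_smul_smul σ w.asIdeal, h]
    exact Ideal.smul_bot _)⟩
  one_smul w := HeightOneSpectrum.ext (one_smul _ w.asIdeal)
  mul_smul σ τ w := HeightOneSpectrum.ext (mul_smul σ τ w.asIdeal)

omit [NumberField L] in
open Pointwise in
theorem smul_asIdeal (σ : Gal(L/K)) (w : HeightOneSpectrum (𝓞 L)) :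
    (σ • w).asIdeal = σ • w.asIdeal := rfl

open Pointwise in
-- On integers this compares multiplicities under the automorphism of the ideal monoid induced by
-- `σ`; fractions follow.
theorem valuation_smul (σ : Gal(L/K)) (w : HeightOneSpectrum (𝓞 L)) (x : L) :
    (σ • w).valuation L (σ x) = w.valuation L x := by
  have key : ∀ a : 𝓞 L, (σ • w).intValuation (σ • a) = w.intValuation a := by
    intro a
    rcases eq_or_ne a 0 with rfl | ha
    · simp
    · have hspan : Ideal.span {σ • a} = σ • Ideal.span {a} := by
        rw [Ideal.pointwise_smul_def, Ideal.map_span, Set.image_singleton]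
        rfl
      rw [HeightOneSpectrum.intValuation_eq_exp_neg_multiplicity _ ha,
        HeightOneSpectrum.intValuation_eq_exp_neg_multiplicity _ ((smul_ne_zero_iff_ne σ).mpr ha),
        hspan, smul_asIdeal]
      congr 3
      exact multiplicity_map_eq (MulDistribMulAction.toMulEquiv (Ideal (𝓞 L)) σ)
  obtain ⟨a, b, -, rfl⟩ := IsFractionRing.div_surjective (A := 𝓞 L) x
  have hσ : ∀ a : 𝓞 L, σ (algebraMap (𝓞 L) L a) = algebraMap (𝓞 L) L (σ • a) := fun _ => rfl
  rw [map_div₀, map_div₀, map_div₀, hσ, hσ]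
  simp only [HeightOneSpectrum.valuation_of_algebraMap, key]

theorem ord_smul (σ : Gal(L/K)) (w : HeightOneSpectrum (𝓞 L)) (x : Lˣ) :
    ord (σ • w) (σ • x) = ord w x := by
  have h := valuation_eq_exp_neg_ord (σ • w) (σ • x)
  rw [AlgEquiv.smul_units_def, Units.coe_map] at h
  have h' := (valuation_smul σ w (x : L)).symm.trans h
  rw [valuation_eq_exp_neg_ord, WithZero.exp_inj, neg_inj] at h'
  exact h'.symm

open Pointwise in
theorem below_smul [NumberField K] (σ : Gal(L/K)) (w : Place L) : (σ • w).below K = w.below K := by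
  rcases w with w | w
  · refine congrArg Sum.inl (HeightOneSpectrum.ext ?_)
    ext x
    have hx : σ⁻¹ • algebraMap (𝓞 K) (𝓞 L) x = algebraMap (𝓞 K) (𝓞 L) x :=
      RingOfIntegers.ext (σ⁻¹.commutes (x : K))
    change algebraMap (𝓞 K) (𝓞 L) x ∈ σ • w.asIdeal ↔ algebraMap (𝓞 K) (𝓞 L) x ∈ w.asIdeal
    rw [Ideal.mem_pointwise_smul_iff_inv_smul_mem, hx]
  · refine congrArg Sum.inr (InfinitePlace.ext _ _ fun x => ?_)
    simp [InfinitePlace.comap_apply]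

theorem exists_smul_eq_of_below_eq [NumberField K] [IsGalois K L] {w w' : Place L}
    (h : w.below K = w'.below K) :
    ∃ σ : Gal(L/K), σ • w = w' := by
  rcases w with w | w <;> rcases w' with w' | w'
  · have : w'.asIdeal.LiesOver (finiteBelow K w).asIdeal :=
      ⟨congrArg HeightOneSpectrum.asIdeal (Sum.inl_injective h)⟩
    obtain ⟨σ, hσ⟩ := Ideal.exists_smul_eq_of_isGaloisGroup (finiteBelow K w).asIdeal w.asIdeal
      w'.asIdeal (hQp := w'.isPrime) Gal(L/K)
    exact ⟨σ, congrArg Sum.inl (HeightOneSpectrum.ext hσ)⟩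
  · simp [Place.below] at h
  · simp [Place.below] at h
  · obtain ⟨σ, hσ⟩ := InfinitePlace.exists_smul_eq_of_comap_eq (Sum.inr_injective h)
    exact ⟨σ, congrArg Sum.inr hσ⟩

end Galois

/-! ### Decomposition groups and local degrees -/

section LocalDegree

/-- Artin's theorem: `E` has degree `|D|` over the fixed field of the image of `D`. -/
theorem card_dvd_finrank {F E D : Type*} [Field F] [Field E] [Algebra F E] [Group D] [Finite D]
    (φ : D →* (E →ₐ[F] E)) (hφ : Function.Injective φ) : Nat.card D ∣ Module.finrank F E := by
  by_cases hfin : FiniteDimensional F E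
  · let ψ : D →* Gal(E/F) := (AlgEquiv.algHomUnitsEquiv F E).toMonoidHom.comp φ.toHomUnits
    have hψ : Function.Injective ψ := (AlgEquiv.algHomUnitsEquiv F E).injective.comp
      fun x y h => hφ (congrArg Units.val h)
    have h := IntermediateField.finrank_fixedField_eq_card ψ.range
    rw [Nat.card_congr (MonoidHom.ofInjective hψ).toEquiv, ← h]
    exact Dvd.intro_left _ (Module.finrank_mul_finrank F (IntermediateField.fixedField ψ.range) E)
  -- In infinite degree `finrank` is `0`, so finiteness of local extensions is not needed.
  · rw [Module.finrank_of_not_finite hfin]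
    exact dvd_zero _

variable {K L : Type*} [Field K] [NumberField K] [Field L] [NumberField L] [Algebra K L]

theorem infinite_card_stabilizer_dvd (w : InfinitePlace L) :
    Nat.card (MulAction.stabilizer Gal(L/K) w) ∣ degreeAbove K (.inr w) := by
  by_cases h : w.IsUnramified K
  · rw [h.stabilizer_eq_bot]
    simp
  · rw [show degreeAbove K (.inr w) = 2 from
      InfinitePlace.IsRamified.finrank_eq_two (w.comap (algebraMap K L)) h]
    rcases InfinitePlace.nat_card_stabilizer_eq_one_or_two K w with h | h <;>
      exact h.dvd.trans (by norm_num)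

variable (w : HeightOneSpectrum (𝓞 L))

/-- The action of an element of the decomposition group of `w` on `L` with the `w`-adic topology. -/
def stabilizerWithVal : MulAction.stabilizer Gal(L/K) w →*
    (WithVal (w.valuation L) →+* WithVal (w.valuation L)) where
  toFun σ := ((WithVal.equiv (w.valuation L)).symm.toRingHom.comp (σ.1 : L ≃+* L).toRingHom).comp
    (WithVal.equiv (w.valuation L)).toRingHom
  map_one' := rfl
  map_mul' _ _ := rfl

omit [NumberField K] in
theorem continuous_stabilizerWithVal (σ : MulAction.stabilizer Gal(L/K) w) :
    Continuous (stabilizerWithVal w σ) := by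
  refine (uniformContinuous_of_continuousAt_zero _ ?_).continuous
  simp_rw [ContinuousAt, map_zero, (Valued.hasBasis_nhds_zero _ _).tendsto_iff
    (Valued.hasBasis_nhds_zero _ _), true_and, forall_const]
  refine fun γ => ⟨γ, fun x hx => ?_⟩
  have h : Valued.v (stabilizerWithVal w σ x) = Valued.v x := by
    have := valuation_smul σ.1 w x.ofVal
    rw [σ.2] at this
    exact this
  have h' : Valued.v.restrict (stabilizerWithVal w σ x) = Valued.v.restrict x :=
    (Valuation.restrict_inj _).mpr h
  simpa [h'] using hx

/-- The action of the decomposition group of `w` on the completion `L_w`. -/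
def stabilizerCompletion : MulAction.stabilizer Gal(L/K) w →*
    (w.adicCompletion L →+* w.adicCompletion L) where
  toFun σ := ((HeightOneSpectrum.adicCompletion.equiv L w).symm.toRingHom.comp
    (UniformSpace.Completion.mapRingHom _ (continuous_stabilizerWithVal w σ))).comp
    (HeightOneSpectrum.adicCompletion.equiv L w).toRingHom
  map_one' := by
    have := UniformSpace.Completion.mapRingHom_id (α := WithVal (w.valuation L))
    exact RingHom.ext fun x => (HeightOneSpectrum.adicCompletion.equiv L w).injective
      (DFunLike.congr_fun this (HeightOneSpectrum.adicCompletion.equiv L w x))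
  map_mul' σ τ := by
    have := UniformSpace.Completion.mapRingHom_comp (continuous_stabilizerWithVal w σ)
      (continuous_stabilizerWithVal w τ)
    exact RingHom.ext fun x => (HeightOneSpectrum.adicCompletion.equiv L w).injective
      (DFunLike.congr_fun this (HeightOneSpectrum.adicCompletion.equiv L w x)).symm

theorem stabilizerCompletion_comp (σ : MulAction.stabilizer Gal(L/K) w) :
    (stabilizerCompletion w σ).comp (finiteCompletionMap K w) = finiteCompletionMap K w := by
  have hf := (HeightOneSpectrum.uniformContinuous_algebraMap_liesOver K L
    (finiteBelow K w) w).continuous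
  have hcomp : (stabilizerWithVal w σ).comp
      (algebraMap (WithVal ((finiteBelow K w).valuation K)) (WithVal (w.valuation L))) =
      algebraMap (WithVal ((finiteBelow K w).valuation K)) (WithVal (w.valuation L)) :=
    RingHom.ext fun x => congrArg (WithVal.equiv (w.valuation L)).symm (σ.1.commutes x.ofVal)
  have h := UniformSpace.Completion.mapRingHom_comp (continuous_stabilizerWithVal w σ) hf
  simp only [hcomp] at h
  exact RingHom.ext fun x => (HeightOneSpectrum.adicCompletion.equiv L w).injective
    (DFunLike.congr_fun h (HeightOneSpectrum.adicCompletion.equiv K (finiteBelow K w) x))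

omit [NumberField K] in
theorem stabilizerCompletion_injective :
    Function.Injective (stabilizerCompletion (K := K) w) := by
  have key : ∀ (σ : MulAction.stabilizer Gal(L/K) w) (x : L),
      (stabilizerCompletion w σ (x : w.adicCompletion L)) = (σ.1 x : w.adicCompletion L) :=
    fun σ x => HeightOneSpectrum.adicCompletion.ext _ _
      (UniformSpace.Completion.mapRingHom_coe (continuous_stabilizerWithVal w σ) _)
  refine fun σ τ h => Subtype.ext (AlgEquiv.ext fun x => ?_)
  have h1 := (key σ x).symm.trans ((DFunLike.congr_fun h _).trans (key τ x))
  have h2 := UniformSpace.Completion.coe_injective _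
    (congrArg HeightOneSpectrum.adicCompletion.toCompletion h1)
  exact congrArg WithVal.ofVal h2

/-- The decomposition group acts faithfully on `L_w` over `K_v`. Divisibility suffices for the
theorem; equality is not needed. -/
theorem finite_card_stabilizer_dvd :
    Nat.card (MulAction.stabilizer Gal(L/K) w) ∣ degreeAbove K (.inl w) := by
  let _ := (finiteCompletionMap K w).toAlgebra
  have : FiniteDimensional K L := Module.Finite.of_restrictScalars_finite ℚ K L
  let φ : MulAction.stabilizer Gal(L/K) w →*
      (w.adicCompletion L →ₐ[(finiteBelow K w).adicCompletion K] w.adicCompletion L) :=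
    { toFun := fun σ => { stabilizerCompletion w σ with
        commutes' := DFunLike.congr_fun (stabilizerCompletion_comp w σ) }
      map_one' := AlgHom.ext fun x =>
        DFunLike.congr_fun (map_one (stabilizerCompletion (K := K) w)) x
      map_mul' := fun σ τ => AlgHom.ext fun x =>
        DFunLike.congr_fun (map_mul (stabilizerCompletion (K := K) w) σ τ) x }
  exact card_dvd_finrank φ fun σ τ h => stabilizerCompletion_injective w
    (RingHom.ext fun x => DFunLike.congr_fun h x)

theorem card_stabilizer_dvd (w : Place L) :
    Nat.card (MulAction.stabilizer Gal(L/K) w) ∣ degreeAbove K w := by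
  rcases w with w | w
  · have h : MulAction.stabilizer Gal(L/K) (Sum.inl w : Place L) =
        MulAction.stabilizer Gal(L/K) w := by
      ext σ
      exact Sum.inl_injective.eq_iff
    rw [h]
    exact finite_card_stabilizer_dvd w
  · have h : MulAction.stabilizer Gal(L/K) (Sum.inr w : Place L) =
        MulAction.stabilizer Gal(L/K) w := by
      ext σ
      exact Sum.inr_injective.eq_iff
    rw [h]
    exact infinite_card_stabilizer_dvd w

end LocalDegree

/-! ### Elements concentrated at a single prime -/

section BasicElements

variable {K L : Type*} [Field K] [Field L] [NumberField L] [Algebra K L]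

theorem ord_smul_apply (σ : Gal(L/K)) (w : HeightOneSpectrum (𝓞 L)) (x : Lˣ) :
    ord w (σ • x) = ord (σ⁻¹ • w) x := by
  rw [← ord_smul σ (σ⁻¹ • w) x, smul_inv_smul]

theorem ord_eq_one_of_unit (w : HeightOneSpectrum (𝓞 L)) (u : (𝓞 L)ˣ) :
    ord w (Units.map (algebraMap (𝓞 L) L).toMonoidHom u) = 1 := by
  have h := valuation_eq_exp_neg_ord w (Units.map (algebraMap (𝓞 L) L).toMonoidHom u)
  have h' : w.valuation L ((Units.map (algebraMap (𝓞 L) L).toMonoidHom u : Lˣ) : L) = 1 :=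
    (HeightOneSpectrum.valuation_of_algebraMap w (u : 𝓞 L)).trans
      (w.intValuation_eq_one_iff.mpr fun hu => w.isPrime.ne_top
        (Ideal.eq_top_of_isUnit_mem _ hu u.isUnit))
  rw [h', ← WithZero.exp_zero, WithZero.exp_inj, eq_comm, neg_eq_zero] at h
  exact h

theorem exists_unit_of_ord_eq_one {x : Lˣ} (hx : ∀ w, ord w x = 1) :
    ∃ u : (𝓞 L)ˣ, Units.map (algebraMap (𝓞 L) L).toMonoidHom u = x := by
  have key : ∀ y : Lˣ, (∀ w, ord w y = 1) → ∃ a : 𝓞 L, algebraMap (𝓞 L) L a = y := fun y hy => by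
    refine (HeightOneSpectrum.mem_integers_of_valuation_le_one L (y : L) fun w => ?_)
    rw [valuation_eq_exp_neg_ord, hy]
    exact le_rfl
  obtain ⟨a, ha⟩ := key x hx
  obtain ⟨b, hb⟩ := key x⁻¹ fun w => by rw [map_inv, hx, inv_one]
  have hab : a * b = 1 := FaithfulSMul.algebraMap_injective (𝓞 L) L (by simp [ha, hb])
  exact ⟨⟨a, b, hab, mul_comm a b ▸ hab⟩, Units.ext ha⟩

/-- `a` is a unit at all finite primes except possibly `w`; if `w` is finite, then `a` has positive
order at `w`, and if `w` is infinite, then `a` is less than `1` at all other infinite primes. -/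
structure IsConcentratedAt (w : Place L) (a : Lˣ) : Prop where
  ord_eq_one : ∀ w', Sum.inl w' ≠ w → ord w' a = 1
  ord_pos : ∀ w', Sum.inl w' = w → 1 < ord w' a
  log_neg : ∀ w₀ w' : InfinitePlace L, Sum.inr w₀ = w → w' ≠ w₀ → Real.log (w' a) < 0

theorem IsConcentratedAt.mul {w : Place L} {a b : Lˣ} (ha : IsConcentratedAt w a)
    (hb : IsConcentratedAt w b) : IsConcentratedAt w (a * b) where
  ord_eq_one w' hw' := by rw [map_mul, ha.ord_eq_one w' hw', hb.ord_eq_one w' hw', one_mul]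
  ord_pos w' hw' := by
    rw [map_mul]
    exact one_lt_mul'' (ha.ord_pos w' hw') (hb.ord_pos w' hw')
  log_neg w₀ w' hw hw' := by
    rw [Units.val_mul, map_mul, Real.log_mul (by simp) (by simp)]
    exact add_neg (ha.log_neg w₀ w' hw hw') (hb.log_neg w₀ w' hw hw')

theorem IsConcentratedAt.smul {w : Place L} {a : Lˣ} (ha : IsConcentratedAt w a) (σ : Gal(L/K)) :
    IsConcentratedAt (σ • w) (σ • a) where
  ord_eq_one w' hw' := by
    rw [ord_smul_apply]
    refine ha.ord_eq_one _ fun h => hw' ?_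
    rw [← h]
    exact congrArg Sum.inl (smul_inv_smul σ w').symm
  ord_pos w' hw' := by
    rw [ord_smul_apply]
    refine ha.ord_pos _ ?_
    rw [← inv_smul_smul σ w, ← hw']
    rfl
  log_neg w₀ w' hw hw' := by
    have h := ha.log_neg (σ⁻¹ • w₀) (σ⁻¹ • w') (by rw [← inv_smul_smul σ w, ← hw]; rfl)
      fun h => hw' (smul_left_cancel _ h)
    rw [InfinitePlace.smul_apply] at h
    exact h

/-- At a finite prime take a generator of `w ^ h` with `h` the class number; at an infinite prime
take a unit from the proof of Dirichlet's theorem. -/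
theorem exists_isConcentratedAt (w : Place L) : ∃ a, IsConcentratedAt w a := by
  rcases w with w | w
  · have : Finite (FracIdeal L ⧸ (toPrincipalIdeal (𝓞 L) L).range) :=
      Finite.of_equiv _ (ClassGroup.equiv (R := 𝓞 L) L).toEquiv
    set h := Nat.card (FracIdeal L ⧸ (toPrincipalIdeal (𝓞 L) L).range) with hh
    have hpos : 0 < h := Nat.card_pos
    obtain ⟨a, ha⟩ : primeIdeal w ^ h ∈ (toPrincipalIdeal (𝓞 L) L).range := by
      rw [← QuotientGroup.eq_one_iff, QuotientGroup.mk_pow]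
      exact pow_card_eq_one'
    have hord : ∀ w', ord w' a = idealOrd w' (primeIdeal w) ^ h := fun w' => by
      rw [ord, MonoidHom.comp_apply, ha, map_pow]
    refine ⟨a, fun w' hw' => ?_, fun w' hw' => ?_, fun w₀ w' hw => by simp at hw⟩
    · rw [hord, idealOrd_primeIdeal_of_ne, one_pow]
      rintro rfl
      exact hw' rfl
    · obtain rfl := Sum.inl_injective hw'
      rw [hord, idealOrd_primeIdeal_self]
      exact one_lt_pow' (by decide) hpos.ne'
  · obtain ⟨u, hu⟩ := Units.dirichletUnitTheorem.exists_unit L w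
    refine ⟨Units.map (algebraMap (𝓞 L) L).toMonoidHom u, fun w' _ => ord_eq_one_of_unit w' u,
      fun w' hw' => by simp at hw', fun w₀ w' hw hw' => ?_⟩
    obtain rfl := Sum.inr_injective hw
    exact hu w' hw'

theorem exists_equivariant_isConcentratedAt [NumberField K] [IsGalois K L] :
    ∃ ε : Place L → Lˣ, (∀ w, IsConcentratedAt w (ε w)) ∧
      ∀ (σ : Gal(L/K)) w, ε (σ • w) = σ • ε w := by
  classical
  have : FiniteDimensional K L := Module.Finite.of_restrictScalars_finite ℚ K L
  choose a ha using exists_isConcentratedAt (L := L)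
  let base : Place L → Place L := fun w => (exists_above L (w.below K)).choose
  have hbase : ∀ w, (base w).below K = w.below K := fun w =>
    (exists_above L (w.below K)).choose_spec
  have hbaseσ : ∀ (σ : Gal(L/K)) w, base (σ • w) = base w := fun σ w => by
    simp only [base, below_smul]
  -- Choose one base prime over each prime of `K`, and multiply the conjugates of its element over
  -- all `τ` carrying the base prime to `w`. Taking all such `τ` removes the dependence on a choice,
  -- and left translation by `σ` permutes the factors.
  refine ⟨fun w => ∏ τ : Gal(L/K) with τ • base w = w, τ • a (base w), fun w => ?_, fun σ w => ?_⟩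
  · refine Finset.prod_induction_nonempty _ (IsConcentratedAt w) (fun _ _ => .mul) ?_ fun τ hτ => ?_
    · obtain ⟨τ, hτ⟩ := exists_smul_eq_of_below_eq (hbase w)
      exact ⟨τ, by simpa using hτ⟩
    · have h := (ha (base w)).smul τ
      rwa [(Finset.mem_filter.mp hτ).2] at h
  · simp only [hbaseσ, Finset.smul_prod']
    refine (Finset.prod_nbij' (fun τ => σ * τ) (fun τ => σ⁻¹ * τ) ?_ ?_ ?_ ?_ ?_).symm
    · simp [mul_smul]
    · simp [mul_smul, inv_smul_eq_iff]
    · simp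
    · simp
    · simp [mul_smul]

end BasicElements

/-! ### The Herbrand quotient of the `S`-units -/

section SUnits

variable {K L : Type*} [Field K] [NumberField K] [Field L] [NumberField L] [Algebra K L]
  {S : Set (Place K)}

instance : MulAction Gal(L/K) (above L S) where
  smul σ w := ⟨σ • w.1, (congrArg (· ∈ S) (below_smul σ w.1)).mpr w.2⟩
  one_smul w := Subtype.ext (one_smul _ w.1)
  mul_smul σ τ w := Subtype.ext (mul_smul σ τ w.1)

theorem smul_mem_above_iff {σ : Gal(L/K)} {w : Place L} : σ • w ∈ above L S ↔ w ∈ above L S :=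
  iff_of_eq (congrArg (· ∈ S) (below_smul σ w))

theorem stabilizer_above (w : above L S) :
    MulAction.stabilizer Gal(L/K) w = MulAction.stabilizer Gal(L/K) w.1 := by
  ext σ
  exact Subtype.ext_iff

theorem finite_above [IsGalois K L] (hS : S.Finite) : (above L S).Finite := by
  have : FiniteDimensional K L := Module.Finite.of_restrictScalars_finite ℚ K L
  refine (hS.biUnion fun v _ => Set.finite_range
    fun σ : Gal(L/K) => σ • (exists_above L v).choose).subset fun w hw => ?_
  obtain ⟨σ, hσ⟩ := exists_smul_eq_of_below_eq (exists_above L (w.below K)).choose_spec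
  exact Set.mem_biUnion hw ⟨σ, hσ⟩

variable (L S) in
/-- The group of `S`-units of `L`. -/
def sUnits : Subgroup Lˣ :=
  (sPrincipal (above L S)).ker

theorem mem_sUnits {x : Lˣ} : x ∈ sUnits L S ↔ ∀ w, Sum.inl w ∉ above L S → ord w x = 1 :=
  mem_ker_sPrincipal

theorem smul_mem_sUnits (σ : Gal(L/K)) {x : Lˣ} (hx : x ∈ sUnits L S) : σ • x ∈ sUnits L S := by
  rw [mem_sUnits] at hx ⊢
  intro w hw
  rw [ord_smul_apply]
  exact hx _ fun h => hw (smul_mem_above_iff (σ := σ⁻¹).mp h)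

theorem IsConcentratedAt.mem_sUnits {w : Place L} {a : Lˣ} (ha : IsConcentratedAt w a)
    (hw : w ∈ above L S) : a ∈ sUnits L S := by
  rw [SCapitulation.mem_sUnits]
  exact fun w' hw' => ha.ord_eq_one w' fun h => hw' (h ▸ hw)

variable (S) in
/-- The action of `σ` on the additively written group of `S`-units. -/
def sUnitsEnd (σ : Gal(L/K)) : AddMonoid.End (Additive (sUnits L S)) :=
  MonoidHom.toAdditive
    { toFun := fun x => ⟨σ • (x : Lˣ), smul_mem_sUnits σ x.2⟩
      map_one' := Subtype.ext (smul_one σ)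
      map_mul' := fun x y => Subtype.ext (smul_mul' σ (x : Lˣ) y) }

theorem coe_sUnitsEnd (σ : Gal(L/K)) (x : Additive (sUnits L S)) :
    ((sUnitsEnd S σ x).toMul : Lˣ) = σ • (x.toMul : Lˣ) := rfl

theorem coe_sUnitsEnd_iterate (σ : Gal(L/K)) (i : ℕ) (x : Additive (sUnits L S)) :
    (((sUnitsEnd S σ)^[i] x).toMul : Lˣ) = σ ^ i • (x.toMul : Lˣ) := by
  induction i with
  | zero => simp
  | succ i ih => rw [Function.iterate_succ_apply', coe_sUnitsEnd, ih, smul_smul, pow_succ']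

theorem sUnitsEnd_pow_orderOf (σ : Gal(L/K)) : sUnitsEnd S σ ^ orderOf σ = 1 := by
  refine DFunLike.ext _ _ fun x => Additive.toMul.injective (Subtype.ext ?_)
  rw [AddMonoid.End.coe_pow, coe_sUnitsEnd_iterate, pow_orderOf_eq_one, one_smul]
  rfl

variable (S) in
/-- The order of an `S`-unit at a finite prime. -/
def sOrd (w : HeightOneSpectrum (𝓞 L)) : Additive (sUnits L S) →+ ℤ :=
  MonoidHom.toAdditiveLeft ((ord w).comp (sUnits L S).subtype)

theorem sOrd_apply (w : HeightOneSpectrum (𝓞 L)) (x : Additive (sUnits L S)) :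
    sOrd S w x = (ord w (x.toMul : Lˣ)).toAdd := rfl

variable (S) in
/-- The inclusion of the units of `𝓞 L` into the `S`-units. -/
def unitsToSUnits : Additive (𝓞 L)ˣ →+ Additive (sUnits L S) :=
  MonoidHom.toAdditive ((Units.map (algebraMap (𝓞 L) L).toMonoidHom).codRestrict (sUnits L S)
    fun u => mem_sUnits.mpr fun w _ => ord_eq_one_of_unit w u)

theorem exists_unitsToSUnits_eq {x : Additive (sUnits L S)}
    (hx : ∀ w, Sum.inl w ∈ above L S → sOrd S w x = 0) : ∃ u, unitsToSUnits S u = x := by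
  obtain ⟨u, hu⟩ := exists_unit_of_ord_eq_one (x := (x.toMul : Lˣ)) fun w => by
    by_cases hw : Sum.inl w ∈ above L S
    · exact hx w hw
    · exact mem_sUnits.mp x.toMul.2 w hw
  exact ⟨.ofMul u, Additive.toMul.injective (Subtype.ext hu)⟩

theorem unitsToSUnits_injective : Function.Injective (unitsToSUnits (L := L) S) := fun _ _ h =>
  Additive.toMul.injective (Units.map_injective (FaithfulSMul.algebraMap_injective (𝓞 L) L)
    (congrArg (fun x : Additive (sUnits L S) => (x.toMul : Lˣ)) h))

/-- The orders at the finitely many finite primes above `S` map `U` to a free module of finite rank,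
with kernel the units of `𝓞 L`. -/
theorem finite_sUnits [Finite (above L S)] : Module.Finite ℤ (Additive (sUnits L S)) := by
  let T := {w : HeightOneSpectrum (𝓞 L) // Sum.inl w ∈ above L S}
  have : Finite T := Finite.of_injective (fun w : T => (⟨Sum.inl w.1, w.2⟩ : above L S))
    fun w w' h => Subtype.ext (Sum.inl_injective (congrArg Subtype.val h))
  let f : Additive (sUnits L S) →ₗ[ℤ] (T → ℤ) :=
    (AddMonoidHom.pi fun w : T => sOrd S w.1).toIntLinearMap
  have hker : LinearMap.ker f = LinearMap.range (unitsToSUnits (L := L) S).toIntLinearMap := by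
    ext x
    constructor
    · intro hx
      exact exists_unitsToSUnits_eq fun w hw => congrFun hx ⟨w, hw⟩
    · rintro ⟨u, rfl⟩
      exact funext fun w => ord_eq_one_of_unit w.1 u.toMul
  refine ⟨Submodule.fg_of_fg_map_of_fg_inf_ker f (IsNoetherian.noetherian _) ?_⟩
  rw [top_inf_eq, hker, LinearMap.range_eq_map]
  exact Module.Finite.fg_top.map _

end SUnits

/-! ### The permutation module as a subgroup of finite index in `ℤ × U`. -/

section Embedding

variable {K L : Type*} [Field K] [NumberField K] [Field L] [NumberField L] [Algebra K L]
  {S : Set (Place K)} [Fintype (above L S)]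

/-- The indicator function of the infinite primes. -/
def inftyIndicator (w : above L S) : ℤ :=
  Sum.elim (fun _ => 0) (fun _ => 1) w.1

/-- The family in `ℤ × U` whose linear combinations form the image of the permutation module. -/
def basicFamily (ε : above L S → Additive (sUnits L S)) (w : above L S) :
    ℤ × Additive (sUnits L S) :=
  (inftyIndicator w, ε w)

variable (hS_inf : ∀ v : InfinitePlace K, Sum.inr v ∈ S)
  {ε : above L S → Additive (sUnits L S)}
  (hε : ∀ w : above L S, IsConcentratedAt w.1 ((ε w).toMul : Lˣ))

omit [Fintype (above L S)] in
include hS_inf in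
theorem inr_mem_above (w : InfinitePlace L) : Sum.inr w ∈ above L S := hS_inf _

omit [Fintype (above L S)] in
include hε in
theorem exists_units_family : ∃ u : InfinitePlace L → Additive (𝓞 L)ˣ,
    (∀ w, unitsToSUnits S (u w) = ε ⟨Sum.inr w, inr_mem_above hS_inf w⟩) ∧
      ∀ w w' : InfinitePlace L, w ≠ w' → Real.log (w' ((u w).toMul : L)) < 0 := by
  have h : ∀ w : InfinitePlace L, ∃ u, unitsToSUnits S u = ε ⟨Sum.inr w, inr_mem_above hS_inf w⟩ :=
    fun w => exists_unitsToSUnits_eq fun w' _ => (hε _).ord_eq_one w' (by simp)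
  choose u hu using h
  refine ⟨u, hu, fun w w' hw => ?_⟩
  have h := (hε ⟨Sum.inr w, inr_mem_above hS_inf w⟩).log_neg w w' rfl hw.symm
  rw [← hu] at h
  exact h

include hε in
theorem sOrd_linComb (f : above L S → ℤ) (t : above L S) (w : HeightOneSpectrum (𝓞 L))
    (hw : Sum.inl w = t.1) : sOrd S w (linComb ε f) = f t * sOrd S w (ε t) := by
  refine (map_sum (sOrd S w) _ _).trans ?_
  refine (Finset.sum_eq_single t (fun t' _ ht' => ?_) (by simp)).trans ?_
  · rw [map_zsmul, sOrd_apply, (hε t').ord_eq_one w fun h => ht' (Subtype.ext (h.symm.trans hw))]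
    simp
  · rw [map_zsmul, smul_eq_mul]

theorem linComb_basicFamily (f : above L S → ℤ) :
    linComb (basicFamily ε) f = (linComb inftyIndicator f, linComb ε f) :=
  Prod.ext (Prod.fst_sum ..) (Prod.snd_sum ..)

theorem prodMap_sumLinComb {u : InfinitePlace L → Additive (𝓞 L)ˣ}
    (hu : ∀ w, unitsToSUnits S (u w) = ε ⟨Sum.inr w, inr_mem_above hS_inf w⟩)
    {f : above L S → ℤ} (hf : ∀ w hw, f ⟨Sum.inl w, hw⟩ = 0) :
    ((AddMonoidHom.id ℤ).prodMap (unitsToSUnits S))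
        (sumLinComb u fun w => f ⟨Sum.inr w, inr_mem_above hS_inf w⟩) =
      linComb (basicFamily ε) f := by
  let i : InfinitePlace L → above L S := fun w => ⟨Sum.inr w, inr_mem_above hS_inf w⟩
  have hi : Function.Injective i := fun w w' h => Sum.inr_injective (congrArg Subtype.val h)
  have h : ∑ w, f (i w) • basicFamily ε (i w) = linComb (basicFamily ε) f := by
    refine Fintype.sum_of_injective i hi _ _ (fun t ht => ?_) fun w => rfl
    obtain ⟨w | w, hw⟩ := t
    · rw [hf, zero_smul]
    · exact absurd ⟨w, rfl⟩ ht
  have h2 : ∑ w, f (i w) • basicFamily ε (i w) =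
      (∑ w, f (i w) • inftyIndicator (i w), ∑ w, f (i w) • ε (i w)) :=
    Prod.ext (Prod.fst_sum ..) (Prod.snd_sum ..)
  rw [← h, h2]
  refine Prod.ext rfl ((map_sum (unitsToSUnits S) (fun w => f (i w) • u w) _).trans
    (Finset.sum_congr rfl fun w _ => ?_))
  rw [map_zsmul, hu]

include hS_inf hε in
-- Orders at finite primes kill the coefficients there, since only one member of the family has
-- nonzero order at each. What remains is the case of units.
theorem linComb_basicFamily_injective : Function.Injective (linComb (basicFamily ε)) := by
  refine (injective_iff_map_eq_zero _).mpr fun f hf => ?_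
  have hf2 : linComb ε f = 0 := congrArg Prod.snd ((linComb_basicFamily f).symm.trans hf)
  have hfin : ∀ (w) (hw : Sum.inl w ∈ above L S), f ⟨Sum.inl w, hw⟩ = 0 := fun w hw => by
    have h := sOrd_linComb hε f ⟨Sum.inl w, hw⟩ w rfl
    rw [hf2, map_zero, eq_comm, mul_eq_zero] at h
    exact h.resolve_right ((hε ⟨Sum.inl w, hw⟩).ord_pos w rfl).ne'
  obtain ⟨u, hu, hlog⟩ := exists_units_family hS_inf hε
  have h := (prodMap_sumLinComb hS_inf hu hfin).trans hf
  rw [← map_zero ((AddMonoidHom.id ℤ).prodMap (unitsToSUnits S))] at h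
  have hinj : Function.Injective ((AddMonoidHom.id ℤ).prodMap (unitsToSUnits (L := L) S)) :=
    Prod.map_injective.mpr ⟨Function.injective_id, unitsToSUnits_injective⟩
  have h' := hinj h
  have h0 := sumLinComb_units_injective hlog (h'.trans (map_zero _).symm)
  funext t
  obtain ⟨w | w, hw⟩ := t
  · exact hfin w hw
  · exact congrFun h0 w

include hS_inf hε in
theorem exists_zsmul_mem_range_linComb_basicFamily (x : ℤ × Additive (sUnits L S)) :
    ∃ k : ℤ, k ≠ 0 ∧ k • x ∈ (linComb (basicFamily ε)).range := by
  obtain ⟨u, hu, hlog⟩ := exists_units_family hS_inf hε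
  -- With `N t` the order of `ε t` at its own prime, multiplying by `∏ N` makes every order of `x.2`
  -- at a finite prime above `S` a multiple of `N t`. Then `g` cancels these orders and leaves a
  -- unit. The values at infinite primes are placeholders that contribute nothing.
  let N : above L S → ℤ := fun t => Sum.elim (fun w => sOrd S w (ε t)) (fun _ => 1) t.1
  let o : above L S → ℤ := fun t => Sum.elim (fun w => sOrd S w x.2) (fun _ => 0) t.1
  let g : above L S → ℤ := fun t => (∏ t, N t) / N t * o t
  have hN : ∏ t, N t ≠ 0 := by
    refine Finset.prod_ne_zero_iff.mpr fun t _ => ?_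
    obtain ⟨w | w, hw⟩ := t
    · exact ((hε ⟨Sum.inl w, hw⟩).ord_pos w rfl).ne'
    · exact one_ne_zero
  obtain ⟨e, he⟩ : ∃ e, unitsToSUnits S e = (∏ t, N t) • x.2 - linComb ε g := by
    refine exists_unitsToSUnits_eq fun w hw => ?_
    rw [map_sub, map_zsmul, sOrd_linComb hε g ⟨Sum.inl w, hw⟩ w rfl, smul_eq_mul, sub_eq_zero]
    have hdvd : N ⟨Sum.inl w, hw⟩ ∣ ∏ t, N t := Finset.dvd_prod_of_mem N (Finset.mem_univ _)
    calc (∏ t, N t) * sOrd S w x.2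
        = (∏ t, N t) / N ⟨Sum.inl w, hw⟩ * N ⟨Sum.inl w, hw⟩ * sOrd S w x.2 := by
          rw [Int.ediv_mul_cancel hdvd]
      _ = (∏ t, N t) / N ⟨Sum.inl w, hw⟩ * sOrd S w x.2 * N ⟨Sum.inl w, hw⟩ := by ring
  obtain ⟨k, hk, c, hc⟩ := exists_zsmul_mem_range_sumLinComb_units hlog
    ((∏ t, N t) • x.1 - linComb inftyIndicator g, e)
  let f : above L S → ℤ := fun t => Sum.elim (fun _ => 0) c t.1
  have h := prodMap_sumLinComb hS_inf hu (f := f) fun _ _ => rfl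
  have hfc : (fun w => f ⟨Sum.inr w, inr_mem_above hS_inf w⟩) = c := rfl
  rw [hfc, hc, map_zsmul] at h
  refine ⟨k * ∏ t, N t, mul_ne_zero hk hN, f + k • g, ?_⟩
  rw [map_add, map_zsmul, ← h]
  refine (zsmul_add _ _ _).symm.trans (Eq.trans (congrArg (k • ·) ?_) (mul_smul _ _ _).symm)
  rw [linComb_basicFamily]
  exact Prod.ext (sub_add_cancel _ _) ((congrArg (· + linComb ε g) he).trans (sub_add_cancel _ _))

include hS_inf hε in
theorem index_range_linComb_basicFamily_ne_zero : (linComb (basicFamily ε)).range.index ≠ 0 := by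
  have := finite_sUnits (L := L) (S := S)
  let R := LinearMap.range (linComb (basicFamily ε)).toIntLinearMap
  have htors : Module.IsTorsion ℤ ((ℤ × Additive (sUnits L S)) ⧸ R) := by
    intro x
    obtain ⟨x, rfl⟩ := Submodule.Quotient.mk_surjective R x
    obtain ⟨k, hk, hx⟩ := exists_zsmul_mem_range_linComb_basicFamily hS_inf hε x
    refine ⟨⟨k, mem_nonZeroDivisors_of_ne_zero hk⟩, ?_⟩
    exact (Submodule.Quotient.mk_eq_zero R).mpr hx
  have hfin : Finite ((ℤ × Additive (sUnits L S)) ⧸ R) := Module.finite_of_fg_torsion _ htors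
  have : Finite ((ℤ × Additive (sUnits L S)) ⧸ (linComb (basicFamily ε)).range) := hfin
  exact AddSubgroup.index_ne_zero_of_finite

end Embedding

/-! ### The divisibility extracted from the Herbrand quotient of `U`. -/

section Herbrand

variable {K L : Type*} [Field K] [NumberField K] [Field L] [NumberField L] [Algebra K L]
  [IsGalois K L] {S : Set (Place K)}

theorem orderOf_dvd_prod_localDegree_mul_kerIndex [Fintype S]
    (hS_inf : ∀ v : InfinitePlace K, Sum.inr v ∈ S) {σ : Gal(L/K)}
    (hσ : ∀ g, g ∈ Subgroup.zpowers σ) :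
    orderOf σ ∣ (∏ v : S, localDegree L (v : Place K)) *
      kerIndex (normEnd (sUnitsEnd S σ) (orderOf σ)) (diffEnd (sUnitsEnd S σ)) := by
  have : FiniteDimensional K L := Module.Finite.of_restrictScalars_finite ℚ K L
  have := (finite_above (L := L) (Set.toFinite S)).fintype
  obtain ⟨ε, hε, hεσ⟩ := exists_equivariant_isConcentratedAt (K := K) (L := L)
  let ε' : above L S → Additive (sUnits L S) := fun w =>
    .ofMul ⟨ε w.1, (hε w.1).mem_sUnits w.2⟩
  have hε' : ∀ w : above L S, IsConcentratedAt w.1 ((ε' w).toMul : Lˣ) := fun w => hε w.1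
  have hequiv : ∀ w : above L S,
      basicFamily ε' (σ • w) = prodEnd (sUnitsEnd S σ) (basicFamily ε' w) := fun w => by
    refine Prod.ext ?_ (Additive.toMul.injective (Subtype.ext (hεσ σ w.1)))
    obtain ⟨w | w, hw⟩ := w <;> rfl
  have h := herbrand_mul_eq (orderOf_pos σ).ne' (sUnitsEnd_pow_orderOf (S := S) σ)
    (permEnd_pow_orderOf (T := above L S) σ) (linComb (basicFamily ε'))
    (linComb_basicFamily_injective hS_inf hε')
    (index_range_linComb_basicFamily_ne_zero hS_inf hε')
    (linComb_permEnd _ σ _ hequiv)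
  have h0 := kerIndex_permEnd_dvd (T := above L S) hσ (fun w => (⟨w.1.below K, w.2⟩ : S))
    (fun v => ⟨(exists_above L v.1).choose, by
      rw [above, Set.mem_preimage, (exists_above L v.1).choose_spec]; exact v.2⟩)
    (fun g w => Subtype.ext (below_smul g w.1))
    (fun w => by
      obtain ⟨g, hg⟩ := exists_smul_eq_of_below_eq (exists_above L (w.1.below K)).choose_spec
      exact ⟨g, Subtype.ext hg⟩)
  have h1 : ∏ v : S, Nat.card (MulAction.stabilizer Gal(L/K) (⟨(exists_above L v.1).choose, by
      rw [above, Set.mem_preimage, (exists_above L v.1).choose_spec]; exact v.2⟩ : above L S)) ∣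
      ∏ v : S, localDegree L (v : Place K) := by
    refine Finset.prod_dvd_prod_of_dvd _ _ fun v _ => ?_
    rw [stabilizer_above]
    exact card_stabilizer_dvd _
  -- The factors `|Ĥ⁰(U)|` and `|H⁻¹(P)|` only make the multiple of `n` larger, so neither has to be
  -- computed.
  refine Dvd.dvd.trans ?_ (mul_dvd_mul_right (h0.trans h1) _)
  rw [h, mul_assoc]
  exact dvd_mul_right _ _

end Herbrand

/-! ### Hilbert's theorem 90 and the group `H¹` of the `S`-units -/

section Hilbert90

variable {K L : Type*} [Field K] [Field L] [Algebra K L]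

/-- The homomorphism `x ↦ σ x / x`. -/
def diffHom (σ : Gal(L/K)) : Lˣ →* Lˣ where
  toFun x := σ • x / x
  map_one' := by simp
  map_mul' x y := by rw [smul_mul', mul_div_mul_comm]

theorem diffHom_apply (σ : Gal(L/K)) (x : Lˣ) : diffHom σ x = σ • x / x := rfl

/-- Hilbert 90 by the resolvent `b = ∑ c i · σ^i z`, where `c i` is the `i`-th partial norm of `x`.
It satisfies `x · σ b = b`, so `y = b⁻¹` works; Dedekind's independence of characters provides `z`
with `b ≠ 0`. -/
theorem exists_diffHom_eq [FiniteDimensional K L] {σ : Gal(L/K)} {x : Lˣ}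
    (hx : ∏ i ∈ Finset.range (orderOf σ), σ ^ i • x = 1) : ∃ y, diffHom σ y = x := by
  let c : ℕ → Lˣ := fun i => ∏ j ∈ Finset.range i, σ ^ j • x
  let F : ℕ → L → L := fun i z => c i * (σ ^ i) z
  obtain ⟨z, hz⟩ : ∃ z, ∑ i ∈ Finset.range (orderOf σ), F i z ≠ 0 := by
    by_contra! h
    have hli := (linearIndependent_monoidHom L L).comp
      (fun i : Fin (orderOf σ) => ((σ ^ (i : ℕ) : Gal(L/K)) : L →* L)) (fun i j hij => by
        refine Fin.ext (pow_injOn_Iio_orderOf i.2 j.2 (AlgEquiv.ext fun z => ?_))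
        exact DFunLike.congr_fun hij z)
    have h0 := Fintype.linearIndependent_iff.mp hli (fun i => (c i : L)) (by
      funext z
      rw [Finset.sum_apply]
      refine Eq.trans ?_ (h z)
      rw [Finset.sum_range]
      rfl) ⟨0, orderOf_pos σ⟩
    exact (c 0).ne_zero h0
  have hstep : ∀ i, F (i + 1) z = x * σ (F i z) := fun i => by
    have hc : c (i + 1) = x * σ • c i := by
      simp only [c]
      rw [Finset.prod_range_succ', Finset.smul_prod', mul_comm, pow_zero, one_smul]
      simp only [smul_smul, pow_succ']
    simp only [F]
    rw [hc, Units.val_mul, map_mul, mul_assoc, pow_succ']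
    rfl
  -- This is where the norm condition enters: it closes the cycle of summands.
  have hwrap : F (orderOf σ) z = F 0 z := by
    simp only [F]
    rw [pow_orderOf_eq_one, pow_zero, show c (orderOf σ) = 1 from hx]
    simp [c]
  have hsum : ∑ i ∈ Finset.range (orderOf σ), F (i + 1) z =
      ∑ i ∈ Finset.range (orderOf σ), F i z := by
    have := (Finset.sum_range_succ' (F · z) (orderOf σ)).symm.trans
      (Finset.sum_range_succ (F · z) (orderOf σ))
    rw [hwrap] at this
    exact add_right_cancel this
  simp_rw [hstep] at hsum
  rw [← Finset.mul_sum, ← map_sum] at hsum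
  refine ⟨(Units.mk0 _ hz)⁻¹, ?_⟩
  rw [diffHom_apply, smul_inv', div_inv_eq_mul, inv_mul_eq_iff_eq_mul, mul_comm]
  exact Units.ext hsum.symm

theorem exists_eq_algebraMap_of_diffHom_eq_one [FiniteDimensional K L] [IsGalois K L]
    {σ : Gal(L/K)} (hσ : ∀ g, g ∈ Subgroup.zpowers σ) {x : Lˣ} (hx : diffHom σ x = 1) :
    ∃ a : Kˣ, Units.map (algebraMap K L).toMonoidHom a = x := by
  have h : σ ∈ MulAction.stabilizer Gal(L/K) x := div_eq_one.mp hx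
  have h' : (x : L) ∈ Set.range (algebraMap K L) := by
    rw [IsGalois.mem_range_algebraMap_iff_fixed]
    intro g
    have hg : g ∈ MulAction.stabilizer Gal(L/K) x := (Subgroup.zpowers_le.mpr h) (hσ g)
    exact congrArg Units.val hg
  obtain ⟨a, ha⟩ := h'
  have ha0 : a ≠ 0 := by
    rintro rfl
    exact x.ne_zero (ha.symm.trans (map_zero _))
  exact ⟨Units.mk0 a ha0, Units.ext ha⟩

theorem diffHom_algebraMap (σ : Gal(L/K)) (a : Kˣ) :
    diffHom σ (Units.map (algebraMap K L).toMonoidHom a) = 1 :=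
  div_eq_one.mpr (Units.ext (σ.commutes (a : K)))

theorem prod_smul_diffHom (σ : Gal(L/K)) (x : Lˣ) (n : ℕ) :
    ∏ i ∈ Finset.range n, σ ^ i • diffHom σ x = σ ^ n • x / x := by
  have h := Finset.prod_range_div (fun i => σ ^ i • x) n
  rw [pow_zero, one_smul] at h
  rw [← h]
  refine Finset.prod_congr rfl fun i _ => ?_
  rw [diffHom_apply, smul_div', smul_smul, pow_succ]

end Hilbert90

/-! ### `H⁻¹(U)` and the capitulation kernel as indices of subgroups of `Lˣ`. -/

section Cohomology

variable {K L : Type*} [Field K] [NumberField K] [Field L] [NumberField L] [Algebra K L]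
  (S : Set (Place K))

/-- By Hilbert 90 the norm-one `S`-units are exactly the `S`-units of the form `σx/x`. Pulling back
along `diffHom` moves the index into `Lˣ`. -/
theorem kerIndex_sUnits_eq {σ : Gal(L/K)} :
    kerIndex (normEnd (sUnitsEnd S σ) (orderOf σ)) (diffEnd (sUnitsEnd S σ)) =
      ((((sUnits L S).map (diffHom σ)).comap (diffHom σ))).relIndex
        ((sUnits L S).comap (diffHom σ)) := by
  have : FiniteDimensional K L := Module.Finite.of_restrictScalars_finite ℚ K L
  let ι : Additive (sUnits L S) →+ Additive Lˣ := MonoidHom.toAdditive (sUnits L S).subtype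
  have hι : Function.Injective ι := fun x y h => Additive.toMul.injective (Subtype.ext h)
  have hnorm : ∀ x : Additive (sUnits L S), (normEnd (sUnitsEnd S σ) (orderOf σ) x = 0 ↔
      ∏ i ∈ Finset.range (orderOf σ), σ ^ i • (x.toMul : Lˣ) = 1) := fun x => by
    rw [← hι.eq_iff, map_zero, normEnd_apply, map_sum]
    exact Iff.of_eq (congrArg (· = 1) (Finset.prod_congr rfl fun i _ =>
      coe_sUnitsEnd_iterate σ i x))
  have h1 : (diffEnd (sUnitsEnd S σ)).range.map ι =
      Subgroup.toAddSubgroup ((sUnits L S).map (diffHom σ)) := by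
    ext y
    constructor
    · rintro ⟨_, ⟨x, rfl⟩, rfl⟩
      exact ⟨(x.toMul : Lˣ), x.toMul.2, rfl⟩
    · rintro ⟨x, hx, rfl⟩
      exact ⟨_, ⟨.ofMul ⟨x, hx⟩, rfl⟩, rfl⟩
  have h2 : (normEnd (sUnitsEnd S σ) (orderOf σ)).ker.map ι =
      Subgroup.toAddSubgroup (((sUnits L S).comap (diffHom σ)).map (diffHom σ)) := by
    ext y
    constructor
    · rintro ⟨x, hx, rfl⟩
      obtain ⟨y, hy⟩ := exists_diffHom_eq ((hnorm x).mp hx)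
      refine ⟨y, ?_, hy⟩
      change diffHom σ y ∈ sUnits L S
      rw [hy]
      exact x.toMul.2
    · rintro ⟨x, hx, rfl⟩
      refine ⟨.ofMul ⟨_, hx⟩, (hnorm _).mpr ?_, rfl⟩
      change ∏ i ∈ Finset.range (orderOf σ), σ ^ i • diffHom σ x = 1
      rw [prod_smul_diffHom, pow_orderOf_eq_one, one_smul, div_self']
  rw [kerIndex, ← AddSubgroup.relIndex_map_map_of_injective _ _ hι, h1, h2, Subgroup.relIndex_comap]
  rfl

/-- Both subgroups are `Kˣ U`: `Kˣ` is the kernel of `x ↦ σx/x`, and `U` is the kernel of `x ↦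
(x)_S`. -/
theorem comap_map_diffHom_eq [IsGalois K L] {σ : Gal(L/K)} (hσ : ∀ g, g ∈ Subgroup.zpowers σ) :
    ((sUnits L S).map (diffHom σ)).comap (diffHom σ) =
      ((sPrincipal S).range.map (sExtend L S)).comap (sPrincipal (above L S)) := by
  have : FiniteDimensional K L := Module.Finite.of_restrictScalars_finite ℚ K L
  have hprinc : ∀ a : Kˣ, sExtend L S (sPrincipal S a) =
      sPrincipal (above L S) (Units.map (algebraMap K L).toMonoidHom a) := fun a =>
    (sExtend_sProj L S _).trans (congrArg _ (extend_toPrincipalIdeal L a))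
  ext x
  constructor
  · rintro ⟨u, hu, hux⟩
    have h : diffHom σ (x / u) = 1 := by rw [map_div, hux, div_self']
    obtain ⟨a, ha⟩ := exists_eq_algebraMap_of_diffHom_eq_one hσ h
    refine ⟨_, ⟨a, rfl⟩, ?_⟩
    rw [hprinc, ha, map_div, show sPrincipal (above L S) u = 1 from hu, div_one]
  · rintro ⟨_, ⟨a, rfl⟩, ha⟩
    rw [hprinc] at ha
    refine ⟨x / Units.map (algebraMap K L).toMonoidHom a, ?_, ?_⟩
    · change sPrincipal (above L S) _ = 1
      rw [map_div, ha, div_self']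
    · rw [map_div, diffHom_algebraMap, div_one]

/-- The kernel consists of the ideals of `K` with principal extension, modulo principal ones.
Injectivity of extension carries this quotient into `J_{L,S}`, and it is then pulled back to `Lˣ`.
-/
theorem card_ker_capitulation [IsGalois K L] : Nat.card (capitulation L S).ker =
    (((sPrincipal S).range.map (sExtend L S)).comap (sPrincipal (above L S))).relIndex
      ((sExtend L S).range.comap (sPrincipal (above L S))) := by
  have h1 : (capitulation L S).ker = ((sPrincipal (above L S)).range.comap (sExtend L S)).map
      (QuotientGroup.mk' (sPrincipal S).range) := QuotientGroup.ker_map _ _ _ _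
  rw [h1, ← Subgroup.relIndex_ker, QuotientGroup.ker_mk', Subgroup.relIndex_comap,
    Subgroup.map_comap_eq, inf_comm, ← Subgroup.map_comap_eq,
    Subgroup.relIndex_map_map_of_injective _ _ (sExtend_injective L S)]

end Cohomology

/-! ### Galois invariant principal `S`-ideals and ramification -/

section Ramification

variable (K L : Type*) [Field K] [NumberField K] [Field L] [NumberField L] [Algebra K L]

theorem exists_finiteBelow_eq (v : HeightOneSpectrum (𝓞 K)) :
    ∃ w : HeightOneSpectrum (𝓞 L), finiteBelow K w = v := by
  obtain ⟨w | w, hw⟩ := exists_above L (Sum.inl v : Place K)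
  · exact ⟨w, Sum.inl_injective hw⟩
  · exact absurd hw (by simp [Place.below])

/-- A ramified prime lies below a divisor of the different, which is a nonzero ideal. Without this
the `finprod` of ramification indices could take its default value `1`. -/
theorem finite_ramified [IsGalois K L] :
    {v : HeightOneSpectrum (𝓞 K) | v.asIdeal.ramificationIdxIn (𝓞 L) ≠ 1}.Finite := by
  have hfin := Ideal.finite_factors (differentIdeal_ne_bot (A := 𝓞 K) (B := 𝓞 L))
  refine (hfin.image (finiteBelow K)).subset fun v hv => ?_
  obtain ⟨w, rfl⟩ := exists_finiteBelow_eq K L v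
  refine ⟨w, ?_, rfl⟩
  set e := (finiteBelow K w).asIdeal.ramificationIdxIn (𝓞 L) with he
  have he0 : e ≠ 0 := Ideal.ramificationIdxIn_ne_zero Gal(L/K)
  have he2 : 2 ≤ e := by
    have : e ≠ 1 := hv
    omega
  have hpow : w.asIdeal ^ e ∣ (finiteBelow K w).asIdeal.map (algebraMap (𝓞 K) (𝓞 L)) := by
    rw [he, Ideal.ramificationIdxIn_eq_ramificationIdx _ w.asIdeal Gal(L/K),
      ← Ideal.ramificationIdx'_eq_ramificationIdx _ _ (finiteBelow K w).ne_bot, Ideal.dvd_iff_le]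
    exact Ideal.le_pow_ramificationIdx'
  have : (finiteBelow K w).asIdeal.IsMaximal := (finiteBelow K w).isMaximal
  exact (dvd_pow_self _ (by omega)).trans
    (pow_sub_one_dvd_differentIdeal (𝓞 K) w.asIdeal e (finiteBelow K w).ne_bot hpow)

end Ramification

/-! ### Invariant principal `S`-ideals compared with ideals extended from `K`. -/

section Invariants

variable {K L : Type*} [Field K] [NumberField K] [Field L] [NumberField L] [Algebra K L]
  [IsGalois K L] (S : Set (Place K))

/-- The condition says that the `S`-ideal of `x` is Galois invariant; the group permutes the primes
above a given `v` transitively. -/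
theorem mem_comap_diffHom_iff {σ : Gal(L/K)} (hσ : ∀ g, g ∈ Subgroup.zpowers σ) {x : Lˣ} :
    x ∈ (sUnits L S).comap (diffHom σ) ↔ ∀ w w' : HeightOneSpectrum (𝓞 L),
      finiteBelow K w = finiteBelow K w' → Sum.inl w ∉ above L S → ord w x = ord w' x := by
  rw [Subgroup.mem_comap, mem_sUnits]
  have hiff : ∀ w, ord w (diffHom σ x) = 1 ↔ ord (σ⁻¹ • w) x = ord w x := fun w => by
    rw [diffHom_apply, map_div, div_eq_one, ord_smul_apply]
  simp_rw [hiff]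
  constructor
  · intro h w w' hw hwS
    -- The elements preserving all orders of `x` outside `S` form a subgroup, so it suffices that
    -- `H` contains the generator.
    let H : Subgroup Gal(L/K) :=
      { carrier := {g | ∀ w, Sum.inl w ∉ above L S → ord (g • w) x = ord w x}
        one_mem' := fun w _ => by rw [one_smul]
        mul_mem' := fun {g g'} hg hg' w hw => by
          rw [mul_smul, hg _ fun h => hw (smul_mem_above_iff (σ := g').mp h), hg' w hw]
        inv_mem' := fun {g} hg w hw => by
          rw [← hg (g⁻¹ • w) fun h => hw (smul_mem_above_iff (σ := g⁻¹).mp h), smul_inv_smul] }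
    have hσH : σ ∈ H := by
      rw [← inv_mem_iff]
      exact h
    obtain ⟨g, hg⟩ := exists_smul_eq_of_below_eq (K := K) (w := Sum.inl w) (w' := Sum.inl w')
      (congrArg Sum.inl hw)
    have hg' : g • w = w' := Sum.inl_injective hg
    rw [← hg']
    exact (((Subgroup.zpowers_le.mpr hσH) (hσ g)) w hwS).symm
  · intro h w hw
    exact (h w (σ⁻¹ • w) (Sum.inl_injective (below_smul σ⁻¹ (Sum.inl w))).symm hw).symm

theorem comap_range_sExtend_le {σ : Gal(L/K)} (hσ : ∀ g, g ∈ Subgroup.zpowers σ) :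
    (sExtend L S).range.comap (sPrincipal (above L S)) ≤ (sUnits L S).comap (diffHom σ) := by
  rintro x ⟨I, hI⟩
  rw [mem_comap_diffHom_iff S hσ]
  have hord : ∀ w, Sum.inl w ∉ above L S → ord w x = idealOrd w (extend L (I : FracIdeal K)) :=
    fun w hw => (idealOrd_sProj_of_notMem hw _).symm.trans
      (congrArg (fun J : sIdeals (above L S) => idealOrd w (J : FracIdeal L)) hI).symm
  intro w w' hww' hw
  have hw' : Sum.inl w' ∉ above L S := fun h => hw (by
    change Sum.inl (finiteBelow K w) ∈ S
    rw [hww']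
    exact h)
  rw [hord w hw, hord w' hw', idealOrd_extend, idealOrd_extend, hww']

theorem mem_range_sExtend_of_dvd {x : Lˣ} (w₀ : HeightOneSpectrum (𝓞 K) → HeightOneSpectrum (𝓞 L))
    (hw₀ : ∀ v, finiteBelow K (w₀ v) = v)
    (hx : ∀ w w' : HeightOneSpectrum (𝓞 L),
      finiteBelow K w = finiteBelow K w' → Sum.inl w ∉ above L S → ord w x = ord w' x)
    (hdvd : ∀ v, Sum.inl v ∉ S →
      (v.asIdeal.ramificationIdxIn (𝓞 L) : ℤ) ∣ (ord (w₀ v) x).toAdd) :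
    sPrincipal (above L S) x ∈ (sExtend L S).range := by
  classical
  have hfin : {v : HeightOneSpectrum (𝓞 K) | ord (w₀ v) x ≠ 1}.Finite := by
    have h := FractionalIdeal.finite_factors
      (toPrincipalIdeal (𝓞 L) L x : FractionalIdeal (𝓞 L)⁰ L)
    rw [Filter.eventually_cofinite] at h
    exact h.preimage (Function.LeftInverse.injective hw₀).injOn
  -- The division is exact for `v ∉ S`; for `v ∈ S` its value is irrelevant, since `sProj` discards
  -- those exponents.
  let a : HeightOneSpectrum (𝓞 K) → ℤ := fun v =>
    (ord (w₀ v) x).toAdd / v.asIdeal.ramificationIdxIn (𝓞 L)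
  let I : FracIdeal K := ∏ v ∈ hfin.toFinset, primeIdeal v ^ a v
  have hI : ∀ v, idealOrd v I = .ofAdd (a v) := fun v => by
    rw [map_prod]
    by_cases hv : v ∈ hfin.toFinset
    · rw [Finset.prod_eq_single_of_mem v hv fun v' _ hv' => by
        rw [map_zpow, idealOrd_primeIdeal_of_ne hv', one_zpow], map_zpow, idealOrd_primeIdeal_self,
        ← ofAdd_zsmul, smul_eq_mul, mul_one]
    · have hv1 : ord (w₀ v) x = 1 := by simpa using hv
      rw [Finset.prod_eq_one fun v' hv' => by
        rw [map_zpow, idealOrd_primeIdeal_of_ne (ne_of_mem_of_not_mem hv' hv), one_zpow]]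
      simp [a, hv1]
  refine ⟨sProj S I, ?_⟩
  rw [sExtend_sProj]
  refine sIdeals_ext fun w hw => ?_
  rw [idealOrd_sProj_of_notMem hw, idealOrd_extend, hI]
  refine Eq.trans ?_ (idealOrd_sProj_of_notMem hw _).symm
  change _ = ord w x
  rw [hx w (w₀ (finiteBelow K w)) (hw₀ _).symm hw, ← ofAdd_nsmul, nsmul_eq_mul, mul_comm]
  exact congrArg Multiplicative.ofAdd (Int.ediv_mul_cancel (hdvd _ hw))

/-- An invariant `S`-ideal has one exponent over each `v ∉ S`, and it is extended from `K` when
every such exponent is divisible by `e(v)`. Residues modulo `e(v)` at the finitely many ramified `v`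
therefore detect the quotient. -/
theorem relIndex_dvd_prod_ramificationIdxIn {σ : Gal(L/K)}
    (hσ : ∀ g, g ∈ Subgroup.zpowers σ) :
    ((sExtend L S).range.comap (sPrincipal (above L S))).relIndex
        ((sUnits L S).comap (diffHom σ)) ∣
      ∏ᶠ v : {v : HeightOneSpectrum (𝓞 K) // Sum.inl v ∉ S},
        v.1.asIdeal.ramificationIdxIn (𝓞 L) := by
  choose w₀ hw₀ using exists_finiteBelow_eq K L
  let V := {v : HeightOneSpectrum (𝓞 K) // Sum.inl v ∉ S}
  let e : V → ℕ := fun v => v.1.asIdeal.ramificationIdxIn (𝓞 L)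
  have hfin : (Function.mulSupport e).Finite :=
    (finite_ramified K L).preimage Subtype.val_injective.injOn
  let Ψ : Lˣ →* ∀ v : hfin.toFinset, Multiplicative (ZMod (e v)) :=
    MonoidHom.pi fun v =>
      (AddMonoidHom.toMultiplicative (Int.castAddHom (ZMod (e v)))).comp (ord (w₀ v.1.1))
  have hcard : Nat.card (∀ v : hfin.toFinset, Multiplicative (ZMod (e v))) = ∏ᶠ v, e v := by
    rw [Nat.card_pi, finprod_eq_prod _ hfin]
    exact (Finset.prod_congr rfl fun v _ => Nat.card_zmod (e v.1)).trans
      (Finset.prod_coe_sort hfin.toFinset e)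
  have hle : Ψ.ker ⊓ (sUnits L S).comap (diffHom σ) ≤
      (sExtend L S).range.comap (sPrincipal (above L S)) := by
    rintro x ⟨hxΨ, hx⟩
    refine mem_range_sExtend_of_dvd S w₀ hw₀ ((mem_comap_diffHom_iff S hσ).mp hx) fun v hv => ?_
    by_cases hev : e ⟨v, hv⟩ = 1
    · change ((e ⟨v, hv⟩ : ℕ) : ℤ) ∣ _
      rw [hev]
      exact one_dvd _
    · exact (ZMod.intCast_zmod_eq_zero_iff_dvd _ _).mp
        (congrFun hxΨ ⟨⟨v, hv⟩, hfin.mem_toFinset.mpr hev⟩)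
  have h1 := Subgroup.relIndex_dvd_of_le_left ((sUnits L S).comap (diffHom σ)) hle
  rw [Subgroup.inf_relIndex_right, Subgroup.relIndex_ker] at h1
  exact h1.trans ((Subgroup.card_subgroup_dvd_card _).trans hcard.dvd)

theorem finrank_dvd_card_ker_mul_eNumber [IsCyclic Gal(L/K)] (hS : S.Finite)
    (hS_inf : ∀ v : InfinitePlace K, Sum.inr v ∈ S) :
    Module.finrank K L ∣ Nat.card (capitulation L S).ker * eNumber L S := by
  have : FiniteDimensional K L := Module.Finite.of_restrictScalars_finite ℚ K L
  have := hS.fintype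
  obtain ⟨σ, hσ⟩ := IsCyclic.exists_generator (α := Gal(L/K))
  rw [← IsGalois.card_aut_eq_finrank, ← orderOf_eq_card_of_forall_mem_zpowers hσ]
  refine (orderOf_dvd_prod_localDegree_mul_kerIndex hS_inf hσ).trans ?_
  rw [kerIndex_sUnits_eq, comap_map_diffHom_eq S hσ, eNumber, finprod_eq_prod_of_fintype,
    ← Subgroup.relIndex_mul_relIndex _ _ _ (Subgroup.comap_mono (Subgroup.map_le_range _ _))
      (comap_range_sExtend_le S hσ), ← card_ker_capitulation, mul_left_comm]
  exact mul_dvd_mul_left _ (mul_dvd_mul_left _ (relIndex_dvd_prod_ramificationIdxIn S hσ))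

end Invariants

end SCapitulation

end

/-- A generalization of Hilbert's Theorem 94 to `S`-ideal classes. -/
theorem mainTheorem6 {K L : Type*} [Field K] [NumberField K] [Field L] [NumberField L]
    [Algebra K L] [IsGalois K L] [IsCyclic Gal(L/K)]
    (S : Set (SCapitulation.Place K)) (hS : S.Finite)
    (hS_inf : ∀ v : NumberField.InfinitePlace K, Sum.inr v ∈ S)
    (n n' : ℕ) (hn : Module.finrank K L = n)
    (hn' : n' = n / Nat.gcd n (SCapitulation.eNumber L S)) :
    n' ≤ Nat.card (SCapitulation.capitulation L S).ker ∧
      n' ∣ Nat.card (SCapitulation.capitulation L S).ker ∧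
      n' ∣ Nat.card (SCapitulation.SClassGroup S) := by
  have : FiniteDimensional K L := Module.Finite.of_restrictScalars_finite ℚ K L
  have hpos : 0 < n := hn ▸ Module.finrank_pos
  have h := SCapitulation.finrank_dvd_card_ker_mul_eNumber (L := L) S hS hS_inf
  have hdvd : n' ∣ Nat.card (SCapitulation.capitulation L S).ker := by
    rw [hn] at h
    rw [hn']
    have hg := Nat.gcd_pos_of_pos_left (SCapitulation.eNumber L S) hpos
    -- After division of `n ∣ |ker j| · e` by `gcd n e`, the cofactor of `|ker j|` is coprime to
    -- `n'`.
    refine (Nat.coprime_div_gcd_div_gcd hg).dvd_of_dvd_mul_right ?_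
    rw [← Nat.mul_div_assoc _ (Nat.gcd_dvd_right _ _)]
    exact Nat.div_dvd_div (Nat.gcd_dvd_left _ _) h
  exact ⟨Nat.le_of_dvd Nat.card_pos hdvd, hdvd, hdvd.trans (Subgroup.card_subgroup_dvd_card _)⟩
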